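/- Let $\mathscr G$ be an ample groupoid, that is, a topological groupoid whose unit space $\mathscr G^{(0)}$ is locally compact and Hausdorff with a basis of compact open sets and whose range map is a local homeomorphism ($\mathscr G$ itself need not be Hausdorff). Write $\boldsymbol d(\gamma)=\gamma^{-1}\gamma$ and $\boldsymbol r(\gamma)=\gamma\gamma^{-1}$ for the source and range of $\gamma$. A bisection is a set of arrows on which $\boldsymbol d$ and $\boldsymbol r$ are injective. Let $\mathcal O=(E,p,\alpha)$ be a $\mathscr G$-sheaf of fields: $p\colon E\to\mathscr G^{(0)}$ is a local homeomorphism, each stalk $\mathcal O_x=p^{-1}(x)$ is a field, addition and multiplication are continuous on $E\times_{p,p}E$, the unit section $x\mapsto 1_x$ is continuous, and $\alpha\colon \mathscr G\times_{\boldsymbol d,p}E\to E$, $(\gamma,e)\mapsto\alpha_\gamma(e)$, is a continuous action of $\mathscr G$ by ring homomorphisms $\alpha_\gamma\colon\mathcal O_{\boldsymbol d(\gamma)}\to\mathcal O_{\boldsymbol r(\gamma)}$ (so $\alpha_x=\mathrm{id}$ for $x\in\mathscr G^{(0)}$, and $\alpha_\beta\alpha_\gamma=\alpha_{\beta\gamma}$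 whenever $\boldsymbol d(\beta)=\boldsymbol r(\gamma)$). Let $\Gamma_c(\mathscr G,\mathcal O)$ be the ring (not necessarily unital) whose additive group is generated, under pointwise addition, by the maps $f\colon\mathscr G\to E$ with $p\circ f=\boldsymbol r$ for which there is a compact open bisection $U$ such that $f|_U$ is continuous and $f$ is zero off $U$, with the convolution product $(f*g)(\gamma)=\sum_{\beta\rho=\gamma}f(\beta)\,\alpha_\beta(g(\rho))$. Let $\Gamma_c(\mathscr G^{(0)},\mathcal O)$ be the subring generated additively by such maps $f$ with $U\subseteq\mathscr G^{(0)}$. Suppose that $\Gamma_c(\mathscr G^{(0)},\mathcal O)$ is a maximal commutative subring of $\Gamma_c(\mathscr G,\mathcal O)$. Then $\Gamma_c(\mathscr G,\mathcal O)$ is left primitive, i.e. has a faithful simple left module, if and only if $\mathscr G^{(0)}$ has a dense orbit, i.e. there is $x\in\mathscr G^{(0)}$ such that $\mathrm{Orb}(x)=\{\boldsymbol r(\gamma)\mid \boldsymbol d(\gamma)=x\}$ is dense in $\mathscr G^{(0)}$. (A simple left module $M$ over a ring $R$ without unit is one with $RM\neq 0$ whose only submodules are $0$ and $M$.) -/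

import Mathlib

open CategoryTheory Topology

universe u v w

namespace GroupoidAlg

section Groupoids

variable (X : Type u) [Groupoid.{v} X]

/-- The arrow space of a groupoid. Its objects are identified with its units. -/
@[ext]
structure Arr where
  /-- the source `d(γ)` -/
  dom : X
  /-- the range `r(γ)` -/
  cod : X
  hom : dom ⟶ cod

variable {X}

/-- An arrow regarded as a point of the arrow space. -/
abbrev arr {x y : X} (f : x ⟶ y) : Arr X := ⟨x, y, f⟩

variable (X)

/-- The space of composable pairs `(snd, fst)`, whose product is `snd · fst` (first `fst`, then
`snd`), written `fst ≫ snd` in Mathlib. -/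
structure ComposablePair where
  {x : X}
  {y : X}
  {z : X}
  fst : x ⟶ y
  snd : y ⟶ z

variable {X}

/-- The product of a composable pair. -/
def ComposablePair.mul (q : ComposablePair X) : Arr X := arr (q.fst ≫ q.snd)

/-- A composable pair as a pair of arrows. -/
def ComposablePair.toProd (q : ComposablePair X) : Arr X × Arr X := (arr q.snd, arr q.fst)

/-- Composable pairs carry the subspace topology of the product. -/
instance [TopologicalSpace (Arr X)] : TopologicalSpace (ComposablePair X) :=
  TopologicalSpace.induced ComposablePair.toProd inferInstance

/-- The unit space as a set of arrows. -/
def units (X : Type u) [Groupoid.{v} X] : Set (Arr X) := Set.range fun x : X => arr (𝟙 x)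

/-- A bisection: a set of arrows on which source and range are injective. -/
def IsBisection (B : Set (Arr X)) : Prop := Set.InjOn Arr.dom B ∧ Set.InjOn Arr.cod B

/-- The orbit `r(d⁻¹(x))` of a unit. -/
def orbit (x : X) : Set X := Arr.cod '' (Arr.dom ⁻¹' {x} : Set (Arr X))

variable (X) [TopologicalSpace X] [TopologicalSpace (Arr X)]

/-- A topological groupoid. Continuity of `x ↦ 𝟙 x` and of the source (or range) map says exactly
that the topology of `X` is the subspace topology of the unit space. -/
class IsTopologicalGroupoid : Prop where
  continuous_dom : Continuous (Arr.dom : Arr X → X)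
  continuous_cod : Continuous (Arr.cod : Arr X → X)
  continuous_id : Continuous fun x : X => arr (𝟙 x)
  continuous_mul : Continuous (ComposablePair.mul : ComposablePair X → Arr X)
  continuous_inv : Continuous fun γ : Arr X => arr (Groupoid.inv γ.hom)

/-- An ample groupoid: an étale groupoid (locally compact Hausdorff unit space, range map a local
homeomorphism; the arrow space need not be Hausdorff) whose unit space has a basis of compact open
sets. -/
class IsAmple : Prop extends IsTopologicalGroupoid X where
  t2Space : T2Space X
  locallyCompactSpace : LocallyCompactSpace X
  isLocalHomeomorph_cod : IsLocalHomeomorph (Arr.cod : Arr X → X)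
  isTopologicalBasis : TopologicalSpace.IsTopologicalBasis {U : Set X | IsCompact U ∧ IsOpen U}

variable {X}

/-- A compact open bisection. (In an étale groupoid an open bisection is homeomorphic to a subspace
of the Hausdorff unit space, so a compact one is automatically Hausdorff.) -/
structure IsCompactOpenBisection (U : Set (Arr X)) : Prop where
  isBisection : IsBisection U
  isCompact : IsCompact U
  isOpen : IsOpen U

end Groupoids

section Sheaves

variable {X : Type u}

/-- The total space of a family of stalks. -/
@[ext]
structure Tot (F : X → Type w) where
  /-- the projection `p` -/
  pt : X
  val : F pt

/-- The fibre product of the total space with itself over `X`. -/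
structure FibrePair (F : X → Type w) where
  pt : X
  fst : F pt
  snd : F pt

def FibrePair.toProd {F : X → Type w} (q : FibrePair F) : Tot F × Tot F :=
  (⟨q.pt, q.fst⟩, ⟨q.pt, q.snd⟩)

/-- The subspace topology of the product. -/
instance {F : X → Type w} [TopologicalSpace (Tot F)] : TopologicalSpace (FibrePair F) :=
  TopologicalSpace.induced FibrePair.toProd inferInstance

/-- The fibre product of the arrow space (via the source map) and the total space. -/
structure ActPair [Groupoid.{v} X] (F : X → Type w) where
  {x : X}
  {y : X}
  hom : x ⟶ y
  val : F x

def ActPair.toProd [Groupoid.{v} X] {F : X → Type w} (q : ActPair F) : Arr X × Tot F :=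
  (arr q.hom, ⟨q.x, q.val⟩)

/-- The subspace topology of the product. -/
instance [Groupoid.{v} X] [TopologicalSpace (Arr X)] {F : X → Type w} [TopologicalSpace (Tot F)] :
    TopologicalSpace (ActPair F) :=
  TopologicalSpace.induced ActPair.toProd inferInstance

/-- A sheaf of unital rings over a topological groupoid: a space `Tot stalk` with a local
homeomorphism to the unit space, unital rings as stalks with fibrewise continuous operations and a
continuous unit section, and a continuous action of the groupoid by ring homomorphisms. -/
structure SheafOfRings (X : Type u) [Groupoid.{v} X] [TopologicalSpace X]
    [TopologicalSpace (Arr X)] where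
  stalk : X → Type w
  ring : ∀ x, Ring (stalk x)
  top : TopologicalSpace (Tot stalk)
  isLocalHomeomorph_pt : IsLocalHomeomorph (Tot.pt : Tot stalk → X)
  act : ∀ {x y : X}, (x ⟶ y) → stalk x →+* stalk y
  continuous_act : Continuous fun q : ActPair stalk => (⟨q.y, act q.hom q.val⟩ : Tot stalk)
  act_id : ∀ (x : X) (e : stalk x), act (𝟙 x) e = e
  act_comp : ∀ {x y z : X} (γ : x ⟶ y) (β : y ⟶ z) (e : stalk x),
    act β (act γ e) = act (γ ≫ β) e
  continuous_add : Continuous fun q : FibrePair stalk => (⟨q.pt, q.fst + q.snd⟩ : Tot stalk)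
  continuous_mul : Continuous fun q : FibrePair stalk => (⟨q.pt, q.fst * q.snd⟩ : Tot stalk)
  continuous_one : Continuous fun x : X => (⟨x, 1⟩ : Tot stalk)

attribute [instance] SheafOfRings.ring SheafOfRings.top

end Sheaves

section Convolution

set_option linter.unusedSectionVars false

variable {X : Type u} [Groupoid.{v} X] [TopologicalSpace X] [TopologicalSpace (Arr X)]
  (O : SheafOfRings.{u, v, w} X)

/-- A 𝒢-sheaf of fields. -/
def SheafOfRings.IsSheafOfFields : Prop := ∀ x, IsField (O.stalk x)

/-- The group of all maps `f` from arrows to the total space with `f γ` in the stalk at `r(γ)`,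
under pointwise addition. -/
abbrev Fn := ∀ γ : Arr X, O.stalk γ.cod

variable {O}

/-- The map from arrows to the total space given by an element of `Fn O`. -/
def Fn.toTot (f : Fn O) (γ : Arr X) : Tot O.stalk := ⟨γ.cod, f γ⟩

/-- `f` is supported on `U`: it is continuous on `U` and zero off `U`. -/
def SupportedOn (f : Fn O) (U : Set (Arr X)) : Prop :=
  ContinuousOn f.toTot U ∧ ∀ γ, γ ∉ U → f γ = 0

variable (O)

/-- The group generated by the maps supported on a compact open bisection contained in `H`. -/
def gammaOn (H : Set (Arr X)) : AddSubgroup (Fn O) :=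
  AddSubgroup.closure {f | ∃ U, IsCompactOpenBisection U ∧ U ⊆ H ∧ SupportedOn f U}

/-- The group `Γ_c(𝒢, 𝒪)`. -/
def Gamma : Type (max u v w) := gammaOn O Set.univ

instance : AddCommGroup (Gamma O) := inferInstanceAs (AddCommGroup (gammaOn O Set.univ))

variable {O}

/-- The factorizations `γ = β ρ`. -/
abbrev Factorization (γ : Arr X) :=
  {q : Σ y : X, (γ.dom ⟶ y) × (y ⟶ γ.cod) // q.2.1 ≫ q.2.2 = γ.hom}

/-- Convolution: the sum over `β ρ = γ` of `f(β) α_β(g(ρ))`. For `f`, `g` in `Γ_c(𝒢, 𝒪)` only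
finitely many terms are nonzero. -/
noncomputable def conv (f g : Fn O) : Fn O := fun γ =>
  ∑ᶠ q : Factorization γ, f (arr q.1.2.2) * O.act q.1.2.2 (g (arr q.1.2.1))

/-- Factorizations of `γ` are determined by their left factor. -/
def factorizationEquiv (γ : Arr X) : Factorization γ ≃ Σ y : X, (y ⟶ γ.cod) where
  toFun q := ⟨q.1.1, q.1.2.2⟩
  invFun b := ⟨⟨b.1, γ.hom ≫ Groupoid.inv b.2, b.2⟩, by simp⟩
  left_inv := by
    rintro ⟨⟨y, ρ, β⟩, h⟩
    dsimp at h
    simp [← h]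
  right_inv _ := rfl

theorem conv_apply (f g : Fn O) {x z : X} (γ : x ⟶ z) :
    conv f g (arr γ) = ∑ᶠ b : Σ y : X, (y ⟶ z),
      f (arr b.2) * O.act b.2 (g (arr (γ ≫ Groupoid.inv b.2))) := by
  unfold conv
  rw [← finsum_comp_equiv (factorizationEquiv (arr γ)).symm]
  rfl

/-- `f` is nonzero at only finitely many points of each fibre of the range map. -/
def FinFib (f : Fn O) : Prop := ∀ z : X, {b : Σ y : X, (y ⟶ z) | f (arr b.2) ≠ 0}.Finite

theorem finFib_of_mem {H : Set (Arr X)} {f : Fn O} (hf : f ∈ gammaOn O H) : FinFib f := by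
  induction hf using AddSubgroup.closure_induction with
  | mem f h =>
    obtain ⟨U, hU, -, -, h0⟩ := h
    intro z
    refine Set.Subsingleton.finite ?_
    rintro ⟨y, b⟩ hb ⟨y', b'⟩ hb'
    have h1 : arr b ∈ U := by
      by_contra hn
      exact hb (h0 _ hn)
    have h2 : arr b' ∈ U := by
      by_contra hn
      exact hb' (h0 _ hn)
    have h3 : arr b = arr b' := hU.isBisection.2 h1 h2 rfl
    cases h3
    rfl
  | zero => intro z; simp
  | add f g _ _ hf hg =>
    intro z
    refine ((hf z).union (hg z)).subset ?_
    intro b hb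
    by_contra hn
    simp only [Set.mem_union, Set.mem_ofPred_eq, not_or, not_not] at hn
    exact hb (by simp [hn.1, hn.2])
  | neg f _ hf => intro z; simpa using hf z

theorem conv_support_finite {f : Fn O} (hf : FinFib f) (g : Fn O) {x z : X} (γ : x ⟶ z) :
    (Function.support (M := O.stalk z) fun b : Σ y : X, (y ⟶ z) =>
      f (arr b.2) * O.act b.2 (g (arr (γ ≫ Groupoid.inv b.2)))).Finite :=
  (hf z).subset fun b hb h0 => hb (by simp [h0])

theorem conv_add {f : Fn O} (hf : FinFib f) (g h : Fn O) :
    conv f (g + h) = conv f g + conv f h := by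
  funext ⟨x, z, γ⟩
  simp only [Pi.add_apply]
  rw [conv_apply, conv_apply, conv_apply,
    ← finsum_add_distrib (conv_support_finite hf g γ) (conv_support_finite hf h γ)]
  simp [mul_add]

theorem add_conv {f g : Fn O} (hf : FinFib f) (hg : FinFib g) (h : Fn O) :
    conv (f + g) h = conv f h + conv g h := by
  funext ⟨x, z, γ⟩
  simp only [Pi.add_apply]
  rw [conv_apply, conv_apply, conv_apply,
    ← finsum_add_distrib (conv_support_finite hf h γ) (conv_support_finite hg h γ)]
  simp [add_mul]

theorem conv_zero (f : Fn O) : conv f 0 = 0 := by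
  funext γ; simp [conv]

theorem zero_conv (f : Fn O) : conv 0 f = 0 := by
  funext γ; simp [conv]

theorem conv_neg (f g : Fn O) : conv f (-g) = -conv f g := by
  funext γ; simp [conv, finsum_neg_distrib]

theorem neg_conv (f g : Fn O) : conv (-f) g = -conv f g := by
  funext γ; simp [conv, finsum_neg_distrib]

/-- Post-composition with `δ` permutes the arrows over a fixed range. -/
def postEquiv {y z : X} (δ : y ⟶ z) : (Σ x : X, (x ⟶ y)) ≃ Σ x : X, (x ⟶ z) where
  toFun b := ⟨b.1, b.2 ≫ δ⟩
  invFun b := ⟨b.1, b.2 ≫ Groupoid.inv δ⟩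
  left_inv b := by simp
  right_inv b := by simp

theorem conv_assoc {f g h : Fn O} (hf : FinFib f) (hg : FinFib g) :
    conv (conv f g) h = conv f (conv g h) := by
  funext ⟨x, z, γ⟩
  let I := Σ y : X, (y ⟶ z)
  let T : I → I → O.stalk z := fun b d =>
    f (arr d.2) * O.act d.2 (g (arr (b.2 ≫ Groupoid.inv d.2))) *
      O.act b.2 (h (arr (γ ≫ Groupoid.inv b.2)))
  have hL : conv (conv f g) h (arr γ) = ∑ᶠ b : I, ∑ᶠ d : I, T b d := by
    rw [conv_apply]
    refine finsum_congr fun b => ?_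
    rw [conv_apply, finsum_mul' _ _ (conv_support_finite hf g b.2)]
  have hR : conv f (conv g h) (arr γ) = ∑ᶠ d : I, ∑ᶠ b : I, T b d := by
    rw [conv_apply]
    refine finsum_congr fun d => ?_
    rw [conv_apply, show ∀ a, O.act d.2 a = (O.act d.2 : _ →+ _) a from fun _ => rfl,
      AddMonoidHom.map_finsum _ (conv_support_finite hg h _), mul_finsum',
      ← finsum_comp_equiv (postEquiv d.2)]
    · refine finsum_congr fun b => ?_
      have h1 : (b.2 ≫ d.2) ≫ Groupoid.inv d.2 = b.2 := by simp
      have h2 : γ ≫ Groupoid.inv (b.2 ≫ d.2) =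
          (γ ≫ Groupoid.inv d.2) ≫ Groupoid.inv b.2 := by simp
      simp only [T, postEquiv, Equiv.coe_fn_mk]
      rw [h1, h2]
      simp [O.act_comp, mul_assoc]
    · refine (hg d.1).subset fun b hb h0 => hb ?_
      simp [h0]
  rw [hL, hR]
  let S : Set (I × I) := {p | f (arr p.2.2) ≠ 0 ∧ g (arr (p.1.2 ≫ Groupoid.inv p.2.2)) ≠ 0}
  have hS : S.Finite := by
    have h1 : (⋃ d ∈ {d : I | f (arr d.2) ≠ 0},
        (fun b : Σ x : X, (x ⟶ d.1) => ((postEquiv d.2 b, d) : I × I)) ''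
          {b | g (arr b.2) ≠ 0}).Finite :=
      (hf z).biUnion fun d _ => (hg d.1).image _
    refine h1.subset ?_
    rintro ⟨b, d⟩ ⟨hp, hq⟩
    simp only [Set.mem_iUnion]
    exact ⟨d, hp, (postEquiv d.2).symm b, hq, by simp⟩
  have hT : (Function.support fun p : I × I => T p.1 p.2).Finite := by
    refine hS.subset fun p hp => ⟨fun h0 => hp ?_, fun h0 => hp ?_⟩ <;> simp [T, h0]
  have hT' : (Function.support fun p : I × I => T p.2 p.1).Finite := by
    have := hT.preimage (f := Prod.swap) Prod.swap_injective.injOn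
    exact this
  rw [← finsum_curry (fun p : I × I => T p.1 p.2) hT,
    ← finsum_curry (fun p : I × I => T p.2 p.1) hT',
    ← finsum_comp_equiv (Equiv.prodComm I I)]
  rfl

theorem conv_mul_of_mem {f g : Fn O} {U : Set (Arr X)} (hU : Set.InjOn Arr.cod U)
    (hf : ∀ γ, γ ∉ U → f γ = 0) (q : ComposablePair X) (hq : arr q.snd ∈ U) :
    conv f g q.mul = f (arr q.snd) * O.act q.snd (g (arr q.fst)) := by
  obtain ⟨ρ, β⟩ := q
  rename_i x y z
  change conv f g (arr (ρ ≫ β)) = _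
  rw [conv_apply, finsum_eq_single _ (⟨y, β⟩ : Σ y : X, (y ⟶ z))]
  · have h : (ρ ≫ β) ≫ Groupoid.inv β = ρ := by simp
    dsimp only
    rw [h]
  · rintro ⟨y', β'⟩ hne
    rw [hf, zero_mul]
    intro hmem
    have h3 : arr β' = arr β := hU hmem hq rfl
    cases h3
    exact hne rfl

/-- The set `U V` of products of composable arrows. -/
def setMul (U V : Set (Arr X)) : Set (Arr X) :=
  ComposablePair.mul '' {q | arr q.snd ∈ U ∧ arr q.fst ∈ V}

theorem setMul_units : setMul (units X) (units X) ⊆ units X := by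
  rintro _ ⟨⟨ρ, β⟩, ⟨⟨x, hx⟩, ⟨y, hy⟩⟩, rfl⟩
  dsimp only at hx hy
  cases hy
  cases hx
  rename_i y
  exact ⟨y, by simp [ComposablePair.mul]⟩

theorem continuous_toProd :
    Continuous (ComposablePair.toProd : ComposablePair X → Arr X × Arr X) :=
  continuous_induced_dom

theorem continuous_snd : Continuous fun q : ComposablePair X => arr q.snd :=
  continuous_fst.comp continuous_toProd

theorem continuous_fst : Continuous fun q : ComposablePair X => arr q.fst :=
  _root_.continuous_snd.comp continuous_toProd

variable [hX : IsAmple X]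

theorem isOpenMap_snd : IsOpenMap fun q : ComposablePair X => arr q.snd := by
  intro W hW
  obtain ⟨W', hW', rfl⟩ := isOpen_induced_iff.1 hW
  rw [isOpen_iff_forall_mem_open]
  rintro _ ⟨q, hq, rfl⟩
  obtain ⟨B, A, hB, hA, hqB, hqA, hBA⟩ := isOpen_prod_iff.1 hW' _ _ hq
  refine ⟨B ∩ Arr.dom ⁻¹' (Arr.cod '' A), ?_,
    hB.inter ((hX.isLocalHomeomorph_cod.isOpenMap A hA).preimage hX.continuous_dom),
    hqB, arr q.fst, hqA, rfl⟩
  rintro ⟨y, z, β⟩ ⟨hβ, ⟨x, y', ρ⟩, hρ, hh⟩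
  dsimp at hh
  subst hh
  exact ⟨⟨ρ, β⟩, hBA ⟨hβ, hρ⟩, rfl⟩

theorem isOpenMap_mul : IsOpenMap (ComposablePair.mul : ComposablePair X → Arr X) := by
  intro W hW
  rw [isOpen_iff_forall_mem_open]
  rintro _ ⟨q, hq, rfl⟩
  obtain ⟨e, he, hee⟩ := hX.isLocalHomeomorph_cod q.mul
  set W' := W ∩ ComposablePair.mul ⁻¹' e.source with hW'
  have hWo : IsOpen W' := hW.inter (e.open_source.preimage hX.continuous_mul)
  have h1 : IsOpen (Arr.cod '' ((fun q : ComposablePair X => arr q.snd) '' W')) :=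
    hX.isLocalHomeomorph_cod.isOpenMap _ (isOpenMap_snd _ hWo)
  refine ⟨e.source ∩ Arr.cod ⁻¹' (Arr.cod '' ((fun q : ComposablePair X => arr q.snd) '' W')),
    ?_, e.open_source.inter (h1.preimage hX.continuous_cod), he, _, ⟨q, ⟨hq, he⟩, rfl⟩, rfl⟩
  rintro γ ⟨hγ, _, ⟨p, hp, rfl⟩, hpγ⟩
  refine ⟨p, hp.1, e.injOn hp.2 hγ ?_⟩
  rw [← hee]
  exact hpγ

theorem isCompactOpenBisection_setMul {U V : Set (Arr X)} (hU : IsCompactOpenBisection U)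
    (hV : IsCompactOpenBisection V) : IsCompactOpenBisection (setMul U V) where
  isBisection := by
    constructor
    · rintro _ ⟨⟨ρ, β⟩, ⟨hβ, hρ⟩, rfl⟩ _ ⟨⟨ρ', β'⟩, ⟨hβ', hρ'⟩, rfl⟩ h
      have h1 := hV.isBisection.1 hρ hρ' h
      cases h1
      have h2 := hU.isBisection.1 hβ hβ' rfl
      cases h2
      rfl
    · rintro _ ⟨⟨ρ, β⟩, ⟨hβ, hρ⟩, rfl⟩ _ ⟨⟨ρ', β'⟩, ⟨hβ', hρ'⟩, rfl⟩ h
      have h1 := hU.isBisection.2 hβ hβ' h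
      cases h1
      have h2 := hV.isBisection.2 hρ hρ' rfl
      cases h2
      rfl
  isOpen := isOpenMap_mul _
    ((hU.isOpen.preimage continuous_snd).inter (hV.isOpen.preimage continuous_fst))
  isCompact := by
    refine IsCompact.image ?_ hX.continuous_mul
    have hi : IsInducing (ComposablePair.toProd : ComposablePair X → Arr X × Arr X) := ⟨rfl⟩
    rw [hi.isCompact_iff]
    have : T2Space X := hX.t2Space
    have hc : IsClosed {p : Arr X × Arr X | p.1.dom = p.2.cod} :=
      isClosed_eq (hX.continuous_dom.comp _root_.continuous_fst)
        (hX.continuous_cod.comp _root_.continuous_snd)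
    convert (hU.isCompact.prod hV.isCompact).inter_right hc using 1
    ext ⟨⟨y, z, β⟩, ⟨x, y', ρ⟩⟩
    constructor
    · rintro ⟨q, ⟨h1, h2⟩, h⟩
      cases h
      exact ⟨⟨h1, h2⟩, rfl⟩
    · rintro ⟨⟨h1, h2⟩, h⟩
      dsimp at h
      subst h
      exact ⟨⟨ρ, β⟩, ⟨h1, h2⟩, rfl⟩

theorem supportedOn_conv {f g : Fn O} {U V : Set (Arr X)} (hU : IsCompactOpenBisection U)
    (hV : IsCompactOpenBisection V) (hf : SupportedOn f U) (hg : SupportedOn g V) :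
    SupportedOn (conv f g) (setMul U V) := by
  constructor
  · rintro _ ⟨q, ⟨hqU, hqV⟩, rfl⟩
    refine ContinuousAt.continuousWithinAt ?_
    have hm : Filter.Tendsto (fun p : ComposablePair X => (conv f g).toTot p.mul) (𝓝 q)
        (𝓝 ((conv f g).toTot q.mul)) := by
      have hPo : ∀ᶠ p : ComposablePair X in 𝓝 q, arr p.snd ∈ U :=
        continuous_snd.continuousAt.eventually (hU.isOpen.mem_nhds hqU)
      have hval : ∀ p : ComposablePair X, arr p.snd ∈ U → (conv f g).toTot p.mul =
          ⟨p.z, f (arr p.snd) * O.act p.snd (g (arr p.fst))⟩ := by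
        intro p hp
        unfold Fn.toTot
        rw [conv_mul_of_mem hU.isBisection.2 hf.2 p hp]
        rfl
      rw [hval q hqU]
      refine Filter.Tendsto.congr' (hPo.mono fun p hp => (hval p hp).symm) ?_
      have hfa : ContinuousAt (fun p : ComposablePair X => f.toTot (arr p.snd)) q :=
        ContinuousAt.comp (f := fun p : ComposablePair X => arr p.snd)
          (hf.1.continuousAt (hU.isOpen.mem_nhds hqU)) continuous_snd.continuousAt
      have hga : ContinuousAt (fun p : ComposablePair X => g.toTot (arr p.fst)) q :=
        ContinuousAt.comp (f := fun p : ComposablePair X => arr p.fst)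
          (hg.1.continuousAt (hV.isOpen.mem_nhds hqV)) continuous_fst.continuousAt
      have hact : ContinuousAt (fun p : ComposablePair X =>
          (⟨p.snd, g (arr p.fst)⟩ : ActPair O.stalk)) q := by
        have hi : IsInducing (ActPair.toProd : ActPair O.stalk → Arr X × Tot O.stalk) := ⟨rfl⟩
        rw [hi.continuousAt_iff]
        exact continuous_snd.continuousAt.prodMk hga
      have hact' : ContinuousAt (fun p : ComposablePair X =>
          (⟨p.z, O.act p.snd (g (arr p.fst))⟩ : Tot O.stalk)) q :=
        ContinuousAt.comp (f := fun p : ComposablePair X =>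
          (⟨p.snd, g (arr p.fst)⟩ : ActPair O.stalk)) O.continuous_act.continuousAt hact
      have hfib : ContinuousAt (fun p : ComposablePair X =>
          (⟨p.z, f (arr p.snd), O.act p.snd (g (arr p.fst))⟩ : FibrePair O.stalk)) q := by
        have hi : IsInducing (FibrePair.toProd : FibrePair O.stalk → Tot O.stalk × Tot O.stalk) :=
          ⟨rfl⟩
        rw [hi.continuousAt_iff]
        exact hfa.prodMk hact'
      exact ContinuousAt.comp (f := fun p : ComposablePair X =>
          (⟨p.z, f (arr p.snd), O.act p.snd (g (arr p.fst))⟩ : FibrePair O.stalk))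
        O.continuous_mul.continuousAt hfib
    exact (Filter.tendsto_map'_iff.2 hm).mono_left (isOpenMap_mul.nhds_le q)
  · rintro ⟨x, z, γ⟩ hγ
    rw [conv_apply]
    refine finsum_eq_zero_of_forall_eq_zero fun b => ?_
    by_cases h1 : arr b.2 ∈ U
    · by_cases h2 : arr (γ ≫ Groupoid.inv b.2) ∈ V
      · refine absurd ⟨⟨γ ≫ Groupoid.inv b.2, b.2⟩, ⟨h1, h2⟩, ?_⟩ hγ
        simp [ComposablePair.mul]
      · rw [hg.2 _ h2, map_zero, mul_zero]
    · rw [hf.2 _ h1, zero_mul]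

theorem conv_mem {H : Set (Arr X)} (hH : setMul H H ⊆ H) {f g : Fn O} (hf : f ∈ gammaOn O H)
    (hg : g ∈ gammaOn O H) : conv f g ∈ gammaOn O H := by
  unfold gammaOn at hf hg
  induction hf, hg using AddSubgroup.closure_induction₂ with
  | mem f g hf hg =>
    obtain ⟨U, hU, hUH, hfU⟩ := hf
    obtain ⟨V, hV, hVH, hgV⟩ := hg
    refine AddSubgroup.subset_closure ⟨setMul U V, isCompactOpenBisection_setMul hU hV, ?_,
      supportedOn_conv hU hV hfU hgV⟩
    exact Set.Subset.trans
      (by rintro _ ⟨q, hq, rfl⟩; exact ⟨q, ⟨hUH hq.1, hVH hq.2⟩, rfl⟩) hH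
  | zero_left g _ => rw [zero_conv]; exact zero_mem _
  | zero_right f _ => rw [conv_zero]; exact zero_mem _
  | add_left f f' g hf hf' hg h h' =>
    rw [add_conv (finFib_of_mem (H := H) hf) (finFib_of_mem (H := H) hf')]
    exact add_mem h h'
  | add_right g g' f hg hg' hf h h' =>
    rw [conv_add (finFib_of_mem (H := H) hf)]
    exact add_mem h h'
  | neg_left f g _ _ h => rw [neg_conv]; exact neg_mem h
  | neg_right f g _ _ h => rw [conv_neg]; exact neg_mem h

variable (O)

/-- The ring `Γ_c(𝒢, 𝒪)` (in general without unit), with convolution as multiplication. -/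
noncomputable instance : NonUnitalRing (Gamma O) where
  __ := (inferInstance : AddCommGroup (Gamma O))
  mul f g := ⟨conv f.1 g.1, conv_mem (Set.subset_univ _) f.2 g.2⟩
  left_distrib f g h := Subtype.ext (conv_add (finFib_of_mem f.2) g.1 h.1)
  right_distrib f g h := Subtype.ext (add_conv (finFib_of_mem f.2) (finFib_of_mem g.2) h.1)
  zero_mul f := Subtype.ext (zero_conv f.1)
  mul_zero f := Subtype.ext (conv_zero f.1)
  mul_assoc f g _ := Subtype.ext (conv_assoc (finFib_of_mem f.2) (finFib_of_mem g.2))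

/-- The diagonal subring `Γ_c(𝒢⁰, 𝒪)` of `Γ_c(𝒢, 𝒪)`, generated as a group by the maps supported
on a compact open set of units. -/
def diagonal : NonUnitalSubring (Gamma O) where
  carrier := {f | f.1 ∈ gammaOn O (units X)}
  add_mem' hf hg := (gammaOn O (units X)).add_mem hf hg
  zero_mem' := (gammaOn O (units X)).zero_mem
  neg_mem' hf := (gammaOn O (units X)).neg_mem hf
  mul_mem' hf hg := conv_mem (setMul_units (X := X)) hf hg

end Convolution

section RingTheory

/-- A maximal commutative subring of a ring that need not have a unit. -/
def IsMaximalCommutative {R : Type u} [NonUnitalRing R] (A : NonUnitalSubring R) : Prop :=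
  Maximal (fun B : NonUnitalSubring R => ∀ a ∈ B, ∀ b ∈ B, a * b = b * a) A

/-- A ring is left primitive if it has a faithful simple left module. A left module over a ring `R`
without unit is given by `φ : R → End(M)`; it is simple if `R M ≠ 0` and it has no submodules but
`0` and `M`. (A simple left module is a quotient of `R`, so modules in the universe of `R`
suffice.) -/
def IsLeftPrimitive (R : Type u) [NonUnitalRing R] : Prop :=
  ∃ (M : Type u) (_ : AddCommGroup M) (φ : R →ₙ+* AddMonoid.End M),
    Function.Injective φ ∧ (∃ r m, φ r m ≠ 0) ∧
      ∀ N : AddSubgroup M, (∀ r, ∀ m ∈ N, φ r m ∈ N) → N = ⊥ ∨ N = ⊤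

end RingTheory

end GroupoidAlg

/-! Write R for Γ_c(𝒢, 𝒪) and 1_V for the characteristic function of a compact open set V of units.

Let M be a faithful simple R-module. Say that m ∈ M has zero germ at y if 1_V m = 0 for some V
containing y. Functions supported on bisections carry germs along arrows, so the elements whose
germs vanish along the orbit of x form a submodule (`GermZero.map`), which is 0 or M. If the orbit
is not dense, some nonempty V misses it; then 1_V M lies in this submodule and is nonzero by
faithfulness, so the submodule is M. Were no orbit dense, all germs of all elements would vanish,
and compactness would give RM = 0 (`map_eq_zero_of_germZero`).

Conversely, R acts on the direct sum of the stalks along an orbit: an arrow β from y to z sends e in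
the stalk at y to f(β) α_β(e) in the stalk at z. This module is simple because stalks are fields and
the finite support of an element can be separated in the Hausdorff unit space
(`exists_orbitAction_eq_component`). For a dense orbit it is faithful: its annihilator is an ideal,
and a nonzero ideal contains a nonzero diagonal element a (`exists_mem_diagonal_of_mem_ideal`).
Nonvanishing is an open condition in a sheaf of fields, so a is nonzero at some point of the dense
orbit, where it acts as a nonzero scalar.

The diagonal element is found by descent on the number of support arrows over a point. Translate an
element of the ideal so that it is nonzero at a unit, and cut it down to a neighbourhood where the
number of non-unit support arrows does not grow (`eventually_ncard_le`). If the result commutes with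
the diagonal, it lies in the diagonal by maximality. Otherwise some commutator with a diagonal
element is nonzero, still in the ideal, and zero at all units, so the count drops. -/

namespace GroupoidAlg

/-! ### Continuity of sections of a sheaf of rings -/

section SheafTools

variable {X : Type u} [Groupoid.{v} X] [TopologicalSpace X] [TopologicalSpace (Arr X)]
  {O : SheafOfRings.{u, v, w} X} {Z : Type*} [TopologicalSpace Z]

/-- Two maps to the total space over the same base map that are continuous at a point and agree
there agree nearby. -/
theorem eventually_eq_of_pt_eq {φ ψ : Z → Tot O.stalk} {z : Z} (hφ : ContinuousAt φ z)
    (hψ : ContinuousAt ψ z) (h : φ z = ψ z) (hpt : ∀ z, (φ z).pt = (ψ z).pt) :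
    ∀ᶠ w in 𝓝 z, φ w = ψ w := by
  obtain ⟨e, he, hee⟩ := O.isLocalHomeomorph_pt (φ z)
  have h1 := hφ.eventually (e.open_source.mem_nhds he)
  have h2 := hψ.eventually (e.open_source.mem_nhds (h ▸ he))
  filter_upwards [h1, h2] with w hw1 hw2
  refine e.injOn hw1 hw2 ?_
  rw [← hee]
  exact hpt w

theorem eventually_val_eq {c : Z → X} {f g : ∀ z, O.stalk (c z)} {z : Z}
    (hf : ContinuousAt (fun z => (⟨c z, f z⟩ : Tot O.stalk)) z)
    (hg : ContinuousAt (fun z => (⟨c z, g z⟩ : Tot O.stalk)) z) (h : f z = g z) :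
    ∀ᶠ w in 𝓝 z, f w = g w := by
  filter_upwards [eventually_eq_of_pt_eq hf hg (by simp [h]) fun _ => rfl] with w hw
  simpa using hw

theorem continuousAt_add {c : Z → X} {f g : ∀ z, O.stalk (c z)} {z : Z}
    (hf : ContinuousAt (fun z => (⟨c z, f z⟩ : Tot O.stalk)) z)
    (hg : ContinuousAt (fun z => (⟨c z, g z⟩ : Tot O.stalk)) z) :
    ContinuousAt (fun z => (⟨c z, f z + g z⟩ : Tot O.stalk)) z := by
  have hi : IsInducing (FibrePair.toProd : FibrePair O.stalk → Tot O.stalk × Tot O.stalk) := ⟨rfl⟩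
  have h : ContinuousAt (fun z => (⟨c z, f z, g z⟩ : FibrePair O.stalk)) z := by
    rw [hi.continuousAt_iff]
    exact hf.prodMk hg
  exact ContinuousAt.comp (f := fun z => (⟨c z, f z, g z⟩ : FibrePair O.stalk))
    O.continuous_add.continuousAt h

theorem continuousAt_mul {c : Z → X} {f g : ∀ z, O.stalk (c z)} {z : Z}
    (hf : ContinuousAt (fun z => (⟨c z, f z⟩ : Tot O.stalk)) z)
    (hg : ContinuousAt (fun z => (⟨c z, g z⟩ : Tot O.stalk)) z) :
    ContinuousAt (fun z => (⟨c z, f z * g z⟩ : Tot O.stalk)) z := by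
  have hi : IsInducing (FibrePair.toProd : FibrePair O.stalk → Tot O.stalk × Tot O.stalk) := ⟨rfl⟩
  have h : ContinuousAt (fun z => (⟨c z, f z, g z⟩ : FibrePair O.stalk)) z := by
    rw [hi.continuousAt_iff]
    exact hf.prodMk hg
  exact ContinuousAt.comp (f := fun z => (⟨c z, f z, g z⟩ : FibrePair O.stalk))
    O.continuous_mul.continuousAt h

/-- Through every point of the total space there is a local section. -/
theorem exists_section (x : X) (v : O.stalk x) :
    ∃ s : ∀ y, O.stalk y, s x = v ∧
      ∀ᶠ y in 𝓝 x, ContinuousAt (fun y => (⟨y, s y⟩ : Tot O.stalk)) y := by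
  obtain ⟨e, he, hee⟩ := O.isLocalHomeomorph_pt ⟨x, v⟩
  have hex : ∀ y, ∃ s : O.stalk y, y ∈ e.target → e.symm y = ⟨y, s⟩ := by
    intro y
    by_cases hy : y ∈ e.target
    · have h1 : (e.symm y).pt = y := by
        have := e.right_inv hy
        rwa [← hee] at this
      generalize e.symm y = t at h1
      obtain ⟨p, t⟩ := t
      dsimp at h1
      subst h1
      exact ⟨t, fun _ => rfl⟩
    · exact ⟨0, fun h => absurd h hy⟩
  choose s hs using hex
  have hx : x ∈ e.target := by
    have := e.map_source he
    rwa [← hee] at this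
  refine ⟨s, ?_, ?_⟩
  · have h2 := hs x hx
    have h3 : e.symm x = ⟨x, v⟩ := by
      have := e.left_inv he
      rwa [← hee] at this
    rw [h3] at h2
    simpa using h2.symm
  · filter_upwards [e.open_target.mem_nhds hx] with y hy
    refine (e.continuousAt_symm hy).congr ?_
    filter_upwards [e.open_target.mem_nhds hy] with z hz
    exact hs z hz

/-- A local section s through 0 satisfies s + s = s at the point, hence nearby, so it coincides
there with the zero section. Continuity of 0 thus need not be an axiom. -/
theorem continuous_zero_section : Continuous fun x : X => (⟨x, 0⟩ : Tot O.stalk) := by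
  rw [continuous_iff_continuousAt]
  intro x
  obtain ⟨s, hs, hc⟩ := exists_section (O := O) x 0
  refine hc.self_of_nhds.congr ?_
  filter_upwards [eventually_val_eq (continuousAt_add hc.self_of_nhds hc.self_of_nhds)
    hc.self_of_nhds (by simp [hs])] with y hy
  simpa using hy

/-- The same device: a local section s through -1 satisfies s + 1 = 0 nearby. Multiplying by this
section makes negation continuous. -/
theorem continuous_neg_one_section : Continuous fun x : X => (⟨x, -1⟩ : Tot O.stalk) := by
  rw [continuous_iff_continuousAt]
  intro x
  obtain ⟨s, hs, hc⟩ := exists_section (O := O) x (-1)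
  refine hc.self_of_nhds.congr ?_
  filter_upwards [eventually_val_eq
    (continuousAt_add hc.self_of_nhds O.continuous_one.continuousAt)
    continuous_zero_section.continuousAt (by simp [hs])] with y hy
  rw [eq_neg_of_add_eq_zero_left hy]

theorem continuousAt_neg {c : Z → X} {f : ∀ z, O.stalk (c z)} {z : Z} (hc : ContinuousAt c z)
    (hf : ContinuousAt (fun z => (⟨c z, f z⟩ : Tot O.stalk)) z) :
    ContinuousAt (fun z => (⟨c z, -f z⟩ : Tot O.stalk)) z := by
  have h1 : ContinuousAt (fun z => (⟨c z, -1⟩ : Tot O.stalk)) z :=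
    ContinuousAt.comp (f := c) continuous_neg_one_section.continuousAt hc
  simpa using continuousAt_mul h1 hf

theorem nontrivial_stalk (hO : O.IsSheafOfFields) (x : X) : Nontrivial (O.stalk x) :=
  (hO x).nontrivial

/-- In a sheaf of fields, a section that is continuous and nonzero at a point is nonzero nearby. -/
theorem eventually_ne_zero (hO : O.IsSheafOfFields) {f : ∀ x, O.stalk x} {x : X}
    (hf : ContinuousAt (fun x => (⟨x, f x⟩ : Tot O.stalk)) x) (h : f x ≠ 0) :
    ∀ᶠ y in 𝓝 x, f y ≠ 0 := by
  -- A local section through the inverse of `f x` has product 1 with `f` at `x`, hence in a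
  -- neighbourhood.
  obtain ⟨b, hb⟩ := (hO x).mul_inv_cancel h
  obtain ⟨s, hs, hc⟩ := exists_section (O := O) x b
  filter_upwards [eventually_val_eq (continuousAt_mul hf hc.self_of_nhds)
    O.continuous_one.continuousAt (by simp [hs, hb])] with y hy h0
  have := nontrivial_stalk hO y
  simp [h0] at hy

end SheafTools

/-! ### The unit space as a set of arrows -/

section Units

variable {X : Type u} [Groupoid.{v} X]

/-- A set of objects as a set of units. -/
def unitSet (V : Set X) : Set (Arr X) := (fun x : X => arr (𝟙 x)) '' V

theorem unitSet_subset (V : Set X) : unitSet V ⊆ units X := Set.image_subset_range _ _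

@[simp]
theorem one_mem_unitSet {V : Set X} {x : X} : arr (𝟙 x) ∈ unitSet V ↔ x ∈ V := by
  constructor
  · rintro ⟨y, hy, h⟩
    cases h
    exact hy
  · exact fun h => ⟨x, h, rfl⟩

theorem eq_one_of_mem_units {γ : Arr X} (h : γ ∈ units X) : γ = arr (𝟙 γ.cod) := by
  obtain ⟨x, rfl⟩ := h
  rfl

theorem isBisection_units : IsBisection (units X) := by
  constructor
  · rintro _ ⟨x, rfl⟩ _ ⟨y, rfl⟩ h
    dsimp at h
    rw [h]
  · rintro _ ⟨x, rfl⟩ _ ⟨y, rfl⟩ h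
    dsimp at h
    rw [h]

end Units

/-! ### Compact open sets and bisections -/

section AmpleTools

variable {X : Type u} [Groupoid.{v} X] [TopologicalSpace X] [TopologicalSpace (Arr X)]
  [hX : IsAmple X]

/-- The range map is injective near a unit: an arrow there whose range has its identity arrow in the
same chart must equal that identity. -/
theorem isOpen_unitSet {V : Set X} (hV : IsOpen V) : IsOpen (unitSet V) := by
  rw [isOpen_iff_forall_mem_open]
  rintro _ ⟨x, hx, rfl⟩
  obtain ⟨e, he, hee⟩ := hX.isLocalHomeomorph_cod (arr (𝟙 x))
  refine ⟨e.source ∩ Arr.cod ⁻¹' (V ∩ (fun x : X => arr (𝟙 x)) ⁻¹' e.source), ?_,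
    e.open_source.inter ((hV.inter (e.open_source.preimage hX.continuous_id)).preimage
      hX.continuous_cod), he, hx, he⟩
  rintro γ ⟨hγ, hV, h1⟩
  refine ⟨γ.cod, hV, e.injOn h1 hγ ?_⟩
  rw [← hee]

theorem isOpen_units : IsOpen (units X) := by
  have := isOpen_unitSet (X := X) isOpen_univ
  rwa [unitSet, Set.image_univ] at this

theorem isCompactOpenBisection_unitSet {V : Set X} (hV : IsCompact V) (hV' : IsOpen V) :
    IsCompactOpenBisection (unitSet V) where
  isBisection := ⟨isBisection_units.1.mono (unitSet_subset V),
    isBisection_units.2.mono (unitSet_subset V)⟩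
  isCompact := hV.image hX.continuous_id
  isOpen := isOpen_unitSet hV'

theorem exists_compactOpen {x : X} {S : Set X} (hS : S ∈ 𝓝 x) :
    ∃ V, IsCompact V ∧ IsOpen V ∧ x ∈ V ∧ V ⊆ S := by
  obtain ⟨V, ⟨h1, h2⟩, h3, h4⟩ := hX.isTopologicalBasis.mem_nhds_iff.1 hS
  exact ⟨V, h1, h2, h3, h4⟩

/-- Compact open bisections form a basis of the arrow space. -/
theorem exists_compactOpenBisection {γ : Arr X} {S : Set (Arr X)} (hS : S ∈ 𝓝 γ) :
    ∃ B, IsCompactOpenBisection B ∧ γ ∈ B ∧ B ⊆ S := by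
  obtain ⟨e, he, hee⟩ := hX.isLocalHomeomorph_cod γ
  obtain ⟨e', he', hee'⟩ := hX.isLocalHomeomorph_cod (arr (Groupoid.inv γ.hom))
  obtain ⟨S', hS'S, hS', hγS'⟩ := mem_nhds_iff.1 hS
  -- The chart `e` makes the range injective on `T`. The chart `e'`, applied to inverses, makes the
  -- source injective, since the source of an arrow is the range of its inverse.
  let T := (S' ∩ (fun γ : Arr X => arr (Groupoid.inv γ.hom)) ⁻¹' e'.source) ∩ e.source
  have hT : IsOpen T := (hS'.inter (e'.open_source.preimage hX.continuous_inv)).inter e.open_source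
  have hγT : γ ∈ T := ⟨⟨hγS', he'⟩, he⟩
  obtain ⟨V, hVc, hVo, hxV, hVT⟩ := exists_compactOpen
    ((hX.isLocalHomeomorph_cod.isOpenMap T hT).mem_nhds ⟨γ, hγT, rfl⟩)
  have hcod : Set.InjOn Arr.cod T := fun a ha b hb h => e.injOn ha.2 hb.2 (by rwa [← hee])
  refine ⟨T ∩ Arr.cod ⁻¹' V, ⟨⟨?_, hcod.mono Set.inter_subset_left⟩, ?_,
    hT.inter (hVo.preimage hX.continuous_cod)⟩, ⟨hγT, hxV⟩, fun a ha => hS'S ha.1.1.1⟩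
  · rintro ⟨a, a', f⟩ ha ⟨b, b', g⟩ hb h
    have h1 := e'.injOn ha.1.1.2 hb.1.1.2 (by rw [← hee']; exact h)
    have h2 : a' = b' := congrArg Arr.dom h1
    exact hcod ha.1 hb.1 h2
  -- The bisection is the image of the compact set `V` under the inverse of the chart `e`.
  · have hVt : V ⊆ e.target := by
      intro z hz
      obtain ⟨a, ha, rfl⟩ := hVT hz
      rw [hee]
      exact e.map_source ha.2
    convert hVc.image_of_continuousOn (e.continuousOn_symm.mono hVt) using 1
    ext a
    constructor
    · rintro ⟨ha, haV⟩
      refine ⟨a.cod, haV, ?_⟩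
      rw [hee]
      exact e.left_inv ha.2
    · rintro ⟨z, hz, rfl⟩
      obtain ⟨b, hb, rfl⟩ := hVT hz
      have : e.symm b.cod = b := by
        rw [hee]
        exact e.left_inv hb.2
      rw [this]
      exact ⟨hb, hz⟩

end AmpleTools

/-! ### Convolution formulas and supports in the range fibres -/

section Convolution

variable {X : Type u} [Groupoid.{v} X] [TopologicalSpace X] [TopologicalSpace (Arr X)]
  {O : SheafOfRings.{u, v, w} X}

open Classical in
/-- The function that agrees with a section `s` of the stalks on `U` and vanishes off `U`. -/
noncomputable def sectionOn (U : Set (Arr X)) (s : ∀ x, O.stalk x) : Fn O :=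
  fun γ => if γ ∈ U then s γ.cod else 0

theorem sectionOn_of_mem {U : Set (Arr X)} (s : ∀ x, O.stalk x) {γ : Arr X} (h : γ ∈ U) :
    sectionOn U s γ = s γ.cod := if_pos h

theorem sectionOn_of_notMem {U : Set (Arr X)} (s : ∀ x, O.stalk x) {γ : Arr X} (h : γ ∉ U) :
    sectionOn U s γ = 0 := if_neg h

theorem diag_conv {a : Fn O} (ha : ∀ γ, γ ∉ units X → a γ = 0) (f : Fn O) (γ : Arr X) :
    conv a f γ = a (arr (𝟙 γ.cod)) * f γ := by
  obtain ⟨x, z, γ⟩ := γ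
  have h := conv_mul_of_mem (f := a) (g := f) isBisection_units.2 ha ⟨γ, 𝟙 z⟩ ⟨z, rfl⟩
  rw [O.act_id] at h
  unfold ComposablePair.mul at h
  dsimp only at h
  rwa [Category.comp_id] at h

/-- Convolution by a function supported on a bisection `C` from the right. -/
theorem conv_mul_of_mem_right (f : Fn O) {b : Fn O} {C : Set (Arr X)} (hC : Set.InjOn Arr.dom C)
    (hb : ∀ γ, γ ∉ C → b γ = 0) {x y z : X} (ρ : x ⟶ y) (β : y ⟶ z) (hρ : arr ρ ∈ C) :
    conv f b (arr (ρ ≫ β)) = f (arr β) * O.act β (b (arr ρ)) := by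
  rw [conv_apply, finsum_eq_single _ (⟨y, β⟩ : Σ y : X, (y ⟶ z))]
  · have h : (ρ ≫ β) ≫ Groupoid.inv β = ρ := by simp
    dsimp only
    rw [h]
  · rintro ⟨y', β'⟩ hne
    by_cases hmem : arr ((ρ ≫ β) ≫ Groupoid.inv β') ∈ C
    · exfalso
      have h3 : arr ((ρ ≫ β) ≫ Groupoid.inv β') = arr ρ := hC hmem hρ rfl
      have h4 : y' = y := congrArg Arr.cod h3
      subst h4
      have h5 : (ρ ≫ β) ≫ Groupoid.inv β' = ρ := by simpa using h3
      apply hne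
      have h6 : ρ ≫ β = ρ ≫ β' := by
        conv_rhs => rw [← h5]
        simp
      rw [cancel_epi] at h6
      rw [h6]
    · rw [hb _ hmem, map_zero, mul_zero]

theorem conv_eq_zero_of_dom (f : Fn O) {b : Fn O} {C : Set (Arr X)}
    (hb : ∀ γ, γ ∉ C → b γ = 0) {γ : Arr X} (hγ : γ.dom ∉ Arr.dom '' C) : conv f b γ = 0 := by
  obtain ⟨x, z, γ⟩ := γ
  rw [conv_apply]
  refine finsum_eq_zero_of_forall_eq_zero fun β => ?_
  rw [hb, map_zero, mul_zero]
  exact fun h => hγ ⟨_, h, rfl⟩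

/-- Together with `diag_conv` this computes commutators with the diagonal pointwise: a left diagonal
factor acts through the range, a right one through the source, transported along the arrow. -/
theorem conv_diag {a : Fn O} (ha : ∀ γ, γ ∉ units X → a γ = 0) (f : Fn O) (γ : Arr X) :
    conv f a γ = f γ * O.act γ.hom (a (arr (𝟙 γ.dom))) := by
  obtain ⟨x, z, γ⟩ := γ
  have h := conv_mul_of_mem_right f isBisection_units.1 ha (𝟙 x) γ ⟨x, rfl⟩
  rwa [Category.id_comp] at h

theorem eq_zero_of_mem_gammaOn {H : Set (Arr X)} {f : Fn O} (hf : f ∈ gammaOn O H) :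
    ∀ γ, γ ∉ H → f γ = 0 := by
  induction hf using AddSubgroup.closure_induction with
  | mem f h =>
    obtain ⟨U, hU, hUH, -, h0⟩ := h
    exact fun γ hγ => h0 γ fun h => hγ (hUH h)
  | zero => exact fun _ _ => rfl
  | add f g _ _ hf hg => exact fun γ hγ => by simp [hf γ hγ, hg γ hγ]
  | neg f _ hf => exact fun γ hγ => by simp [hf γ hγ]

theorem finite_cod_support {f : Fn O} (hf : FinFib f) (z : X) :
    {γ : Arr X | γ.cod = z ∧ f γ ≠ 0}.Finite := by
  refine ((hf z).image fun b => arr b.2).subset ?_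
  rintro ⟨x, y, γ⟩ ⟨rfl, h⟩
  exact ⟨⟨x, γ⟩, h, rfl⟩

/-- Counterpart of `FinFib` for sources. It keeps the orbit module stable: an element concentrated
at one point is spread over finitely many ranges. -/
theorem finite_dom_support {H : Set (Arr X)} {f : Fn O} (hf : f ∈ gammaOn O H) (x : X) :
    {γ : Arr X | γ.dom = x ∧ f γ ≠ 0}.Finite := by
  induction hf using AddSubgroup.closure_induction with
  | mem f h =>
    obtain ⟨U, hU, -, -, h0⟩ := h
    refine Set.Subsingleton.finite ?_
    rintro γ ⟨hγ, hf⟩ γ' ⟨hγ', hf'⟩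
    exact hU.isBisection.1 (by_contra fun h => hf (h0 _ h)) (by_contra fun h => hf' (h0 _ h))
      (hγ.trans hγ'.symm)
  | zero => simp
  | add f g _ _ hf hg =>
    refine (hf.union hg).subset ?_
    rintro γ ⟨hγ, h⟩
    by_contra hn
    simp only [Set.mem_union, Set.mem_ofPred_eq, not_or, not_and, not_not] at hn
    exact h (by simp [hn.1 hγ, hn.2 hγ])
  | neg f _ hf => simpa using hf

variable [hX : IsAmple X]

theorem supportedOn_sectionOn {U : Set (Arr X)} (hU : IsOpen U) {s : ∀ x, O.stalk x}
    (hs : ∀ γ ∈ U, ContinuousAt (fun x => (⟨x, s x⟩ : Tot O.stalk)) γ.cod) :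
    SupportedOn (sectionOn U s) U := by
  refine ⟨fun γ hγ => ContinuousAt.continuousWithinAt ?_, fun γ h => sectionOn_of_notMem s h⟩
  have h1 : ContinuousAt (fun γ : Arr X => (⟨γ.cod, s γ.cod⟩ : Tot O.stalk)) γ :=
    ContinuousAt.comp (f := Arr.cod) (hs γ hγ) hX.continuous_cod.continuousAt
  refine h1.congr ?_
  filter_upwards [hU.mem_nhds hγ] with δ hδ
  unfold Fn.toTot
  rw [sectionOn_of_mem s hδ]

theorem sectionOn_mem {H U : Set (Arr X)} (hU : IsCompactOpenBisection U) (hUH : U ⊆ H)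
    {s : ∀ x, O.stalk x}
    (hs : ∀ γ ∈ U, ContinuousAt (fun x => (⟨x, s x⟩ : Tot O.stalk)) γ.cod) :
    sectionOn U s ∈ gammaOn O H :=
  AddSubgroup.subset_closure ⟨U, hU, hUH, supportedOn_sectionOn hU.isOpen hs⟩

/-- Through every point of a stalk there is a section over arbitrarily small compact open
bisections. -/
theorem exists_sectionOn {γ : Arr X} {S : Set (Arr X)} (hS : S ∈ 𝓝 γ) (v : O.stalk γ.cod) :
    ∃ U s, IsCompactOpenBisection U ∧ γ ∈ U ∧ U ⊆ S ∧ s γ.cod = v ∧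
      ∀ H, U ⊆ H → sectionOn (O := O) U s ∈ gammaOn O H := by
  obtain ⟨s, hs, hc⟩ := exists_section γ.cod v
  obtain ⟨U, hU, hγ, hUS⟩ := exists_compactOpenBisection
    (Filter.inter_mem hS (hX.continuous_cod.continuousAt.eventually hc))
  exact ⟨U, s, hU, hγ, fun δ hδ => (hUS hδ).1, hs,
    fun H hH => sectionOn_mem hU hH fun δ hδ => (hUS hδ).2⟩

/-- The arrow space need not be Hausdorff, so extension by zero off a compact open bisection can be
discontinuous. On the diagonal this cannot happen, because compact sets in the Hausdorff unit space
are closed. -/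
theorem continuous_diag {a : Fn O} (ha : a ∈ gammaOn O (units X)) :
    Continuous fun x : X => (⟨x, a (arr (𝟙 x))⟩ : Tot O.stalk) := by
  rw [continuous_iff_continuousAt]
  intro x
  induction ha using AddSubgroup.closure_induction with
  | mem f h =>
    obtain ⟨U, hU, hUH, hc, h0⟩ := h
    by_cases hx : arr (𝟙 x) ∈ U
    · exact ContinuousAt.comp (f := fun x : X => arr (𝟙 x))
        (hc.continuousAt (hU.isOpen.mem_nhds hx)) hX.continuous_id.continuousAt
    · have : T2Space X := hX.t2Space
      have h1 : IsClosed (Arr.cod '' U) := (hU.isCompact.image hX.continuous_cod).isClosed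
      have h2 : x ∉ Arr.cod '' U := by
        rintro ⟨γ, hγ, rfl⟩
        rw [← eq_one_of_mem_units (hUH hγ)] at hx
        exact hx hγ
      refine continuous_zero_section.continuousAt.congr ?_
      filter_upwards [h1.isOpen_compl.mem_nhds h2] with y hy
      rw [h0]
      exact fun h => hy ⟨_, h, rfl⟩
  | zero => exact continuous_zero_section.continuousAt
  | add f g _ _ hf hg => exact continuousAt_add hf hg
  | neg f _ hf => exact continuousAt_neg continuousAt_id hf

/-- Near a point `x`, an element of `Γ_c(𝒢, 𝒪)` is a sum of functions that are continuous at
the distinct arrows with range `x` and supported near them. -/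
theorem exists_local_decomposition {B : Arr X → Set (Arr X)} (hBo : ∀ γ, IsOpen (B γ))
    (hB : ∀ γ, γ ∈ B γ) {f : Fn O} (hf : f ∈ gammaOn O Set.univ) (x : X) :
    ∃ (F : Finset (Arr X)) (h : Arr X → Fn O), (∀ γ ∈ F, γ.cod = x) ∧
      (∀ γ, ContinuousAt (h γ).toTot γ) ∧ (∀ γ, γ ∉ F → h γ = 0) ∧
      ∀ᶠ y in 𝓝 x, ∀ δ : Arr X, δ.cod = y →
        (∀ γ, h γ δ ≠ 0 → δ ∈ B γ) ∧ f δ = ∑ γ ∈ F, h γ δ := by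
  classical
  have hz : ∀ γ : Arr X, ContinuousAt (Fn.toTot (0 : Fn O)) γ := fun γ =>
    (continuous_zero_section.comp hX.continuous_cod).continuousAt
  induction hf using AddSubgroup.closure_induction with
  | mem f h =>
    obtain ⟨U, hU, -, hc, h0⟩ := h
    -- If `U` has an arrow `γ` over `x`, it is the only one, and over nearby points `U` stays inside
    -- `B γ`. Otherwise `U` has no arrows over a neighbourhood of `x`, because its range is compact,
    -- hence closed.
    by_cases hx : x ∈ Arr.cod '' U
    · obtain ⟨γ, hγ, rfl⟩ := hx
      refine ⟨{γ}, fun γ' => if γ' = γ then f else 0, by simp, ?_, ?_, ?_⟩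
      · intro γ'
        by_cases h : γ' = γ
        · subst h
          simpa using hc.continuousAt (hU.isOpen.mem_nhds hγ)
        · simpa [h] using hz γ'
      · intro γ' h
        simp only [Finset.mem_singleton] at h
        simp [h]
      · have ho := hX.isLocalHomeomorph_cod.isOpenMap _ (hU.isOpen.inter (hBo γ))
        filter_upwards [ho.mem_nhds ⟨γ, ⟨hγ, hB γ⟩, rfl⟩] with y hy δ hδ
        refine ⟨?_, by simp⟩
        intro γ' h
        by_cases hγ' : γ' = γ
        · subst hγ'
          simp only [if_true] at h
          have hδU : δ ∈ U := by_contra fun hn => h (h0 _ hn)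
          obtain ⟨ε, hε, rfl⟩ := hy
          rw [hU.isBisection.2 hδU hε.1 hδ]
          exact hε.2
        · simp [hγ'] at h
    · refine ⟨∅, fun _ => 0, by simp, hz, by simp, ?_⟩
      have : T2Space X := hX.t2Space
      have h1 : IsClosed (Arr.cod '' U) := (hU.isCompact.image hX.continuous_cod).isClosed
      filter_upwards [h1.isOpen_compl.mem_nhds hx] with y hy δ hδ
      refine ⟨by simp, ?_⟩
      rw [h0]
      · simp
      · rintro h
        exact hy ⟨δ, h, hδ⟩
  | zero => exact ⟨∅, fun _ => 0, by simp, hz, by simp, Filter.Eventually.of_forall (by simp)⟩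
  | add f g _ _ hf hg =>
    obtain ⟨F, h, h1, h2, h3, h4⟩ := hf
    obtain ⟨F', h', h1', h2', h3', h4'⟩ := hg
    refine ⟨F ∪ F', fun γ => h γ + h' γ, ?_, fun γ => continuousAt_add (h2 γ) (h2' γ), ?_, ?_⟩
    · intro γ hγ
      rcases Finset.mem_union.1 hγ with hγ | hγ
      exacts [h1 γ hγ, h1' γ hγ]
    · intro γ hγ
      rw [Finset.mem_union, not_or] at hγ
      simp only [h3 γ hγ.1, h3' γ hγ.2, add_zero]
    · filter_upwards [h4, h4'] with y hy hy' δ hδ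
      refine ⟨fun γ hne => ?_, ?_⟩
      · by_contra hn
        have e1 : h γ δ = 0 := by_contra fun h => hn ((hy δ hδ).1 γ h)
        have e2 : h' γ δ = 0 := by_contra fun h => hn ((hy' δ hδ).1 γ h)
        exact hne (by simp [e1, e2])
      · simp only [Pi.add_apply]
        rw [Finset.sum_add_distrib, (hy δ hδ).2, (hy' δ hδ).2]
        congr 1
        · refine Finset.sum_subset Finset.subset_union_left fun γ _ hγ => ?_
          rw [h3 γ hγ]
          rfl
        · refine Finset.sum_subset Finset.subset_union_right fun γ _ hγ => ?_
          rw [h3' γ hγ]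
          rfl
  | neg f _ hf =>
    obtain ⟨F, h, h1, h2, h3, h4⟩ := hf
    refine ⟨F, fun γ => -h γ, h1,
      fun γ => continuousAt_neg hX.continuous_cod.continuousAt (h2 γ), ?_, ?_⟩
    · intro γ hγ
      simp only [h3 γ hγ, neg_zero]
    · filter_upwards [h4] with y hy δ hδ
      exact ⟨fun γ hne => (hy δ hδ).1 γ (by simpa using hne), by simp [(hy δ hδ).2]⟩

/-- The support of an element of `Γ_c(𝒢, 𝒪)` in the fibres of the range map is upper
semicontinuous. -/
theorem eventually_support_subset {B : Arr X → Set (Arr X)} (hBo : ∀ γ, IsOpen (B γ))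
    (hB : ∀ γ, γ ∈ B γ) (hBi : ∀ γ, Set.InjOn Arr.cod (B γ)) {f : Fn O}
    (hf : f ∈ gammaOn O Set.univ) (x : X) :
    ∀ᶠ y in 𝓝 x, ∀ δ : Arr X, δ.cod = y → f δ ≠ 0 → ∃ γ : Arr X, γ.cod = x ∧ f γ ≠ 0 ∧ δ ∈ B γ := by
  obtain ⟨F, h, h1, h2, h3, h4⟩ := exists_local_decomposition hBo hB hf x
  -- Each `B γ'` contains only one arrow over `x`, namely `γ'`, so the other summands vanish at `γ`.
  have hval : ∀ γ ∈ F, f γ = h γ γ := by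
    intro γ hγ
    have h5 := h4.self_of_nhds γ (h1 γ hγ)
    rw [h5.2, Finset.sum_eq_single γ]
    · intro γ' hγ' hne
      by_contra hn
      exact hne (hBi γ' (hB γ') (h5.1 γ' hn) ((h1 γ' hγ').trans (h1 γ hγ).symm))
    · exact fun h => absurd hγ h
  -- If `f γ = 0`, then `h γ` agrees with the zero section near `γ`. Injectivity of the range on `B
  -- γ` ensures that this neighbourhood contains every arrow of `B γ` over points close to `x`.
  -- Hence only arrows in the support of `f` contribute.
  have h6 : ∀ᶠ y in 𝓝 x, ∀ γ ∈ F, f γ = 0 → ∀ δ : Arr X, δ.cod = y → δ ∈ B γ → h γ δ = 0 := by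
    rw [Filter.eventually_all_finset]
    intro γ hγ
    by_cases h0 : f γ = 0
    · have hz : ContinuousAt (fun δ : Arr X => (⟨δ.cod, 0⟩ : Tot O.stalk)) γ :=
        (continuous_zero_section.comp hX.continuous_cod).continuousAt
      have h7 := eventually_val_eq (h2 γ) hz (by rw [← hval γ hγ, h0])
      obtain ⟨S, hS, hSo, hγS⟩ := mem_nhds_iff.1 h7
      have ho := hX.isLocalHomeomorph_cod.isOpenMap _ (hSo.inter (hBo γ))
      filter_upwards [ho.mem_nhds ⟨γ, ⟨hγS, hB γ⟩, h1 γ hγ⟩] with y hy _ δ hδ hδB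
      obtain ⟨ε, hε, rfl⟩ := hy
      rw [hBi γ hδB hε.2 hδ]
      exact hS hε.1
    · exact Filter.Eventually.of_forall fun y h => absurd h h0
  filter_upwards [h4, h6] with y hy hy' δ hδ hne
  rw [(hy δ hδ).2] at hne
  obtain ⟨γ, hγ, hne⟩ := Finset.exists_ne_zero_of_sum_ne_zero hne
  have hδB := (hy δ hδ).1 γ hne
  exact ⟨γ, h1 γ hγ, fun h0 => hne (hy' γ hγ h0 δ hδ hδB), hδB⟩

/-- Send a support arrow over `y` to a support arrow `γ` over `x` with `B γ` containing it. This is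
injective since each `B γ` meets the fibre over `y` at most once. As the units are open, `B γ` may
be taken inside them when `γ` is a unit, so non-units go to non-units. Leaving the units out of the
count is what makes the later descent strict. -/
theorem eventually_ncard_le {f : Fn O} (hf : f ∈ gammaOn O Set.univ) (x : X) :
    ∀ᶠ y in 𝓝 x, {γ : Arr X | γ.cod = y ∧ f γ ≠ 0 ∧ γ ∉ units X}.ncard ≤
      {γ : Arr X | γ.cod = x ∧ f γ ≠ 0 ∧ γ ∉ units X}.ncard := by
  have hex : ∀ γ : Arr X, ∃ B : Set (Arr X), IsOpen B ∧ γ ∈ B ∧ Set.InjOn Arr.cod B ∧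
      (γ ∈ units X → B ⊆ units X) := by
    intro γ
    by_cases h : γ ∈ units X
    · exact ⟨units X, isOpen_units, h, isBisection_units.2, fun _ => subset_rfl⟩
    · obtain ⟨B, hB, hγ, -⟩ := exists_compactOpenBisection (γ := γ) Filter.univ_mem
      exact ⟨B, hB.isOpen, hγ, hB.isBisection.2, fun h' => absurd h' h⟩
  choose B hBo hB hBi hBu using hex
  filter_upwards [eventually_support_subset hBo hB hBi hf x] with y hy
  choose! c hc using hy
  refine Set.ncard_le_ncard_of_injOn c ?_ ?_ ?_
  · rintro δ ⟨h1, h2, h3⟩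
    obtain ⟨h4, h5, h6⟩ := hc δ h1 h2
    exact ⟨h4, h5, fun h => h3 (hBu _ h h6)⟩
  · rintro δ ⟨h1, h2, h3⟩ δ' ⟨h1', h2', h3'⟩ h
    refine hBi _ (hc δ h1 h2).2.2 ?_ (h1.trans h1'.symm)
    rw [h]
    exact (hc δ' h1' h2').2.2
  · exact (finite_cod_support (finFib_of_mem hf) x).subset fun γ h => ⟨h.1, h.2.1⟩

end Convolution

/-- A maximal commutative subring contains its centralizer. -/
theorem IsMaximalCommutative.mem_of_commute {R : Type u} [NonUnitalRing R]
    {A : NonUnitalSubring R} (hA : IsMaximalCommutative A) {z : R}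
    (hz : ∀ a ∈ A, a * z = z * a) : z ∈ A := by
  have hcomm : ∀ a ∈ insert z (A : Set R), ∀ b ∈ insert z (A : Set R), a * b = b * a := by
    rintro a (rfl | ha) b (rfl | hb)
    · rfl
    · exact (hz b hb).symm
    · exact hz a ha
    · exact hA.prop a ha b hb
  have := NonUnitalSubring.isMulCommutative_closure hcomm
  refine hA.le_of_ge (y := NonUnitalSubring.closure (insert z (A : Set R)))
    (fun a ha b hb => setLike_mul_comm ha hb) ?_ (NonUnitalSubring.subset_closure (.inl rfl))
  exact fun a ha => NonUnitalSubring.subset_closure (.inr ha)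

/-! ### Nonzero ideals meet a maximal commutative diagonal -/

section Ring

variable {X : Type u} [Groupoid.{v} X] [TopologicalSpace X] [TopologicalSpace (Arr X)]
  {O : SheafOfRings.{u, v, w} X} [hX : IsAmple X]

theorem Gamma.mul_val (f g : Gamma O) : (f * g).1 = conv f.1 g.1 := rfl

@[elab_as_elim]
theorem Gamma.induction {p : Gamma O → Prop}
    (supported : ∀ (f : Gamma O) (U : Set (Arr X)), IsCompactOpenBisection U →
      SupportedOn f.1 U → p f)
    (zero : p 0) (add : ∀ f g, p f → p g → p (f + g)) (neg : ∀ f, p f → p (-f)) (f : Gamma O) :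
    p f := by
  obtain ⟨f, hf⟩ := f
  unfold gammaOn at hf
  induction hf using AddSubgroup.closure_induction with
  | mem f h =>
    obtain ⟨U, hU, -, hf⟩ := h
    exact supported _ U hU hf
  | zero => exact zero
  | add f g _ _ hf hg => exact add _ _ hf hg
  | neg f _ hf => exact neg _ hf

variable (O) in
/-- The characteristic function of a compact open set of units. -/
noncomputable def charFn (V : Set X) (hV : IsCompact V ∧ IsOpen V) : Gamma O :=
  ⟨sectionOn (unitSet V) fun _ => 1,
    sectionOn_mem (isCompactOpenBisection_unitSet hV.1 hV.2) (Set.subset_univ _)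
      fun _ _ => O.continuous_one.continuousAt⟩

theorem charFn_of_notMem_units {V : Set X} (hV : IsCompact V ∧ IsOpen V) (γ : Arr X)
    (hγ : γ ∉ units X) : (charFn O V hV).1 γ = 0 :=
  sectionOn_of_notMem (fun _ => 1) fun h => hγ (unitSet_subset V h)

theorem charFn_one_of_mem {V : Set X} (hV : IsCompact V ∧ IsOpen V) {x : X} (hx : x ∈ V) :
    (charFn O V hV).1 (arr (𝟙 x)) = 1 :=
  sectionOn_of_mem (fun _ => 1) (one_mem_unitSet.2 hx)

theorem charFn_one_of_notMem {V : Set X} (hV : IsCompact V ∧ IsOpen V) {x : X} (hx : x ∉ V) :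
    (charFn O V hV).1 (arr (𝟙 x)) = 0 :=
  sectionOn_of_notMem (fun _ => 1) fun h => hx (one_mem_unitSet.1 h)

theorem charFn_mul_of_mem {V : Set X} (hV : IsCompact V ∧ IsOpen V) (f : Gamma O) {γ : Arr X}
    (hγ : γ.cod ∈ V) : (charFn O V hV * f).1 γ = f.1 γ := by
  rw [Gamma.mul_val, diag_conv (charFn_of_notMem_units hV), charFn_one_of_mem hV hγ, one_mul]

theorem charFn_mul_of_notMem {V : Set X} (hV : IsCompact V ∧ IsOpen V) (f : Gamma O) {γ : Arr X}
    (hγ : γ.cod ∉ V) : (charFn O V hV * f).1 γ = 0 := by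
  rw [Gamma.mul_val, diag_conv (charFn_of_notMem_units hV), charFn_one_of_notMem hV hγ, zero_mul]

theorem mul_charFn_of_mem {V : Set X} (hV : IsCompact V ∧ IsOpen V) (f : Gamma O) {γ : Arr X}
    (hγ : γ.dom ∈ V) : (f * charFn O V hV).1 γ = f.1 γ := by
  rw [Gamma.mul_val, conv_diag (charFn_of_notMem_units hV), charFn_one_of_mem hV hγ, map_one,
    mul_one]

theorem mul_charFn_of_notMem {V : Set X} (hV : IsCompact V ∧ IsOpen V) (f : Gamma O) {γ : Arr X}
    (hγ : γ.dom ∉ V) : (f * charFn O V hV).1 γ = 0 := by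
  rw [Gamma.mul_val, conv_diag (charFn_of_notMem_units hV), charFn_one_of_notMem hV hγ, map_zero,
    mul_zero]

/-- A nonzero element of an ideal can be moved to be nonzero at a unit without enlarging its
support in the fibre of the range map. -/
theorem exists_mul_ne_zero_at_unit (f : Gamma O) {γ : Arr X} (hγ : f.1 γ ≠ 0) :
    ∃ b : Gamma O, (f * b).1 (arr (𝟙 γ.cod)) ≠ 0 ∧
      {δ : Arr X | δ.cod = γ.cod ∧ (f * b).1 δ ≠ 0}.ncard ≤
        {δ : Arr X | δ.cod = γ.cod ∧ f.1 δ ≠ 0}.ncard := by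
  obtain ⟨x, z, γ⟩ := γ
  -- Right convolution with the characteristic function of a bisection around the inverse of `γ` is
  -- a translation, moving the value at `γ` to the unit at its range.
  obtain ⟨C, hC, hγC, -⟩ := exists_compactOpenBisection (γ := arr (Groupoid.inv γ))
    Filter.univ_mem
  let b : Gamma O := ⟨sectionOn C fun _ => 1, sectionOn_mem hC (Set.subset_univ _)
      fun _ _ => O.continuous_one.continuousAt⟩
  have hb : ∀ γ, γ ∉ C → b.1 γ = 0 := fun γ h => sectionOn_of_notMem (fun _ => 1) h
  have key : ∀ {a c d : X} (ρ : a ⟶ c) (β : c ⟶ d), arr ρ ∈ C →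
      (f * b).1 (arr (ρ ≫ β)) = f.1 (arr β) := by
    intro a c d ρ β hρ
    have hbρ : b.1 (arr ρ) = 1 := sectionOn_of_mem (fun _ => 1) hρ
    rw [Gamma.mul_val, conv_mul_of_mem_right f.1 hC.isBisection.1 hb ρ β hρ, hbρ, map_one, mul_one]
  refine ⟨b, ?_, ?_⟩
  · have h := key (Groupoid.inv γ) γ hγC
    rw [Groupoid.inv_comp] at h
    dsimp only
    rw [h]
    exact hγ
  -- Every support arrow of `f * b` is a product βρ with ρ in `C` and β in the support of `f`. Since
  -- the range is injective on `C`, β determines ρ, so the passage to β is injective and preserves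
  -- the range.
  · have hex : ∀ δ : Arr X, (f * b).1 δ ≠ 0 →
        ∃ q : ComposablePair X, q.mul = δ ∧ arr q.fst ∈ C ∧ f.1 (arr q.snd) ≠ 0 := by
      rintro ⟨p, r, δ⟩ hδ
      have hdom : p ∈ Arr.dom '' C := by
        by_contra hn
        exact hδ (conv_eq_zero_of_dom f.1 hb hn)
      obtain ⟨⟨p, q, ρ⟩, hρ, rfl⟩ := hdom
      dsimp only at δ hδ
      have hδ' : ρ ≫ Groupoid.inv ρ ≫ δ = δ := by simp
      refine ⟨⟨ρ, Groupoid.inv ρ ≫ δ⟩, by rw [ComposablePair.mul, hδ'], hρ, ?_⟩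
      rwa [← key ρ _ hρ, hδ']
    have : Nonempty (ComposablePair X) := ⟨⟨γ, 𝟙 z⟩⟩
    choose! q hq using hex
    refine Set.ncard_le_ncard_of_injOn (fun δ => arr (q δ).snd) ?_ ?_
      (finite_cod_support (finFib_of_mem f.2) z)
    · rintro δ ⟨h1, h2⟩
      refine ⟨?_, (hq δ h2).2.2⟩
      exact (congrArg Arr.cod (hq δ h2).1).trans h1
    · rintro δ ⟨-, h⟩ δ' ⟨-, h'⟩ heq
      obtain ⟨h1, h2, -⟩ := hq δ h
      obtain ⟨h1', h2', -⟩ := hq δ' h'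
      dsimp only at heq
      rw [← h1, ← h1']
      generalize q δ = s at *
      generalize q δ' = t at *
      obtain ⟨ρ, β⟩ := s
      obtain ⟨ρ', β'⟩ := t
      dsimp only at heq h2 h2'
      cases heq
      have h3 := hC.isBisection.2 h2 h2' rfl
      cases h3
      rfl

/-- If the diagonal is maximal commutative, then it meets every nonzero ideal. -/
theorem exists_mem_diagonal_of_mem_ideal (hO : O.IsSheafOfFields)
    (hmax : IsMaximalCommutative (diagonal O)) (I : AddSubgroup (Gamma O))
    (hl : ∀ r, ∀ f ∈ I, r * f ∈ I) (hr : ∀ r, ∀ f ∈ I, f * r ∈ I) {f : Gamma O} (hf : f ∈ I)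
    (hf0 : f ≠ 0) : ∃ a ∈ diagonal O, a ∈ I ∧ a ≠ 0 := by
  have main : ∀ (n : ℕ) (f : Gamma O) (γ : Arr X), f ∈ I → f.1 γ ≠ 0 →
      {δ : Arr X | δ.cod = γ.cod ∧ f.1 δ ≠ 0}.ncard = n → ∃ a ∈ diagonal O, a ∈ I ∧ a ≠ 0 := by
    intro n
    induction n using Nat.strong_induction_on with
    | h n ih =>
      intro f γ hf hγ hn
      obtain ⟨b, hb, hle⟩ := exists_mul_ne_zero_at_unit f hγ
      -- Over every point of `V`, the product has at most as many non-unit support arrows as over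
      -- the range of `γ`.
      obtain ⟨V, hVc, hVo, hxV, hVS⟩ := exists_compactOpen (eventually_ncard_le (f * b).2 γ.cod)
      set g := f * b with hg
      let h := charFn O V ⟨hVc, hVo⟩ * g
      have hgI : g ∈ I := hr _ _ hf
      have hhI : h ∈ I := hl _ _ hgI
      by_cases hc : ∀ a ∈ diagonal O, a * h = h * a
      · refine ⟨h, hmax.mem_of_commute hc, hhI, fun h0 => hb ?_⟩
        rw [← charFn_mul_of_mem ⟨hVc, hVo⟩ g (γ := arr (𝟙 γ.cod)) hxV]
        change h.1 _ = 0
        rw [h0]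
        rfl
      · push Not at hc
        obtain ⟨a, ha, hne⟩ := hc
        have ha0 := eq_zero_of_mem_gammaOn (show a.1 ∈ gammaOn O (units X) from ha)
        let k := a * h - h * a
        have hkI : k ∈ I := I.sub_mem (hl _ _ hhI) (hr _ _ hhI)
        have hk : ∀ δ, k.1 δ = a.1 (arr (𝟙 δ.cod)) * h.1 δ -
            h.1 δ * O.act δ.hom (a.1 (arr (𝟙 δ.dom))) := by
          intro δ
          change conv a.1 h.1 δ - conv h.1 a.1 δ = _
          rw [diag_conv ha0, conv_diag ha0]
        have hk0 : ∃ δ, k.1 δ ≠ 0 := by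
          by_contra hn
          push Not at hn
          exact hne (sub_eq_zero.1 (Subtype.ext (funext hn)))
        obtain ⟨δ, hδ⟩ := hk0
        have hhV : ∀ ε : Arr X, h.1 ε ≠ 0 → ε.cod ∈ V ∧ g.1 ε ≠ 0 := by
          intro ε hε
          by_cases hεV : ε.cod ∈ V
          · exact ⟨hεV, by rwa [← charFn_mul_of_mem ⟨hVc, hVo⟩ g hεV]⟩
          · exact absurd (charFn_mul_of_notMem ⟨hVc, hVo⟩ g hεV) hε
        -- At a unit the two terms of the commutator agree, since the unit acts trivially and the
        -- stalk is commutative.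
        have hkh : ∀ ε, k.1 ε ≠ 0 → h.1 ε ≠ 0 ∧ ε ∉ units X := by
          intro ε hε
          refine ⟨fun h0 => hε (by rw [hk, h0, mul_zero, zero_mul, sub_zero]), ?_⟩
          rintro ⟨x, rfl⟩
          apply hε
          rw [hk]
          dsimp only
          rw [O.act_id, (hO x).mul_comm, sub_self]
        have hδV := (hhV δ (hkh δ hδ).1).1
        refine ih _ ?_ k δ hkI hδ rfl
        have fin : ∀ z, {ε : Arr X | ε.cod = z ∧ g.1 ε ≠ 0}.Finite :=
          finite_cod_support (finFib_of_mem g.2)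
        -- The drop is strict because `g` is nonzero at the unit over the range of `γ`, which the
        -- count of non-units omits.
        calc _ ≤ {ε : Arr X | ε.cod = δ.cod ∧ g.1 ε ≠ 0 ∧ ε ∉ units X}.ncard :=
              Set.ncard_le_ncard (fun ε hε => ⟨hε.1, (hhV ε (hkh ε hε.2).1).2, (hkh ε hε.2).2⟩)
                ((fin δ.cod).subset fun ε hε => ⟨hε.1, hε.2.1⟩)
          _ ≤ _ := hVS hδV
          _ < {ε : Arr X | ε.cod = γ.cod ∧ g.1 ε ≠ 0}.ncard :=
              Set.ncard_lt_ncard ⟨fun ε hε => ⟨hε.1, hε.2.1⟩,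
                fun hs => (hs (a := arr (𝟙 γ.cod)) ⟨rfl, hb⟩).2.2 ⟨γ.cod, rfl⟩⟩ (fin γ.cod)
          _ ≤ n := hn ▸ hle
  obtain ⟨γ, hγ⟩ : ∃ γ, f.1 γ ≠ 0 := by
    by_contra hn
    push Not at hn
    exact hf0 (Subtype.ext (funext hn))
  exact main _ f γ hf hγ rfl

end Ring

/-! ### Germs of module elements: primitivity gives a dense orbit -/

section DenseOrbit

theorem mem_orbit_of_hom {X : Type u} [Groupoid.{v} X] {x y z : X} (hy : y ∈ orbit x) (f : z ⟶ y) : z ∈ orbit x := by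
  obtain ⟨⟨a, b, g⟩, ha, hb⟩ := hy
  dsimp at hb
  subst hb
  exact ⟨⟨a, z, g ≫ Groupoid.inv f⟩, ha, rfl⟩

variable {X : Type u} [Groupoid.{v} X] [TopologicalSpace X] [TopologicalSpace (Arr X)]
  {O : SheafOfRings.{u, v, w} X} [hX : IsAmple X]

theorem charFn_mul_charFn_of_subset {V W : Set X} (hV : IsCompact V ∧ IsOpen V)
    (hW : IsCompact W ∧ IsOpen W) (h : V ⊆ W) :
    charFn O V hV * charFn O W hW = charFn O V hV := by
  refine Subtype.ext (funext fun γ => ?_)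
  by_cases hγ : γ ∈ units X
  · obtain ⟨x, rfl⟩ := hγ
    by_cases hx : x ∈ V
    · rw [charFn_mul_of_mem hV _ hx, charFn_one_of_mem hV hx, charFn_one_of_mem hW (h hx)]
    · rw [charFn_mul_of_notMem hV _ hx, charFn_one_of_notMem hV hx]
  · rw [charFn_of_notMem_units hV γ hγ]
    by_cases hx : γ.cod ∈ V
    · rw [charFn_mul_of_mem hV _ hx, charFn_of_notMem_units hW γ hγ]
    · rw [charFn_mul_of_notMem hV _ hx]

theorem charFn_mul_charFn_of_disjoint {V W : Set X} (hV : IsCompact V ∧ IsOpen V)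
    (hW : IsCompact W ∧ IsOpen W) (h : Disjoint V W) :
    charFn O V hV * charFn O W hW = 0 := by
  refine Subtype.ext (funext fun γ => ?_)
  by_cases hx : γ.cod ∈ V
  · rw [charFn_mul_of_mem hV _ hx]
    by_cases hγ : γ ∈ units X
    · obtain ⟨x, rfl⟩ := hγ
      exact charFn_one_of_notMem hW (Set.disjoint_left.1 h hx)
    · exact charFn_of_notMem_units hW γ hγ
  · exact charFn_mul_of_notMem hV _ hx

/-- Inclusion-exclusion for characteristic functions. -/
theorem charFn_union {V W : Set X} (hV : IsCompact V ∧ IsOpen V) (hW : IsCompact W ∧ IsOpen W)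
    (hVW : IsCompact (V ∪ W) ∧ IsOpen (V ∪ W)) :
    charFn O (V ∪ W) hVW = charFn O V hV + charFn O W hW - charFn O V hV * charFn O W hW := by
  refine Subtype.ext (funext fun γ => ?_)
  change _ = (charFn O V hV).1 γ + (charFn O W hW).1 γ - (charFn O V hV * charFn O W hW).1 γ
  by_cases hγ : γ ∈ units X
  · obtain ⟨x, rfl⟩ := hγ
    by_cases hx : x ∈ V
    · rw [charFn_mul_of_mem hV _ hx, charFn_one_of_mem hV hx, charFn_one_of_mem hVW (.inl hx)]
      simp
    · rw [charFn_mul_of_notMem hV _ hx, charFn_one_of_notMem hV hx]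
      by_cases hx' : x ∈ W
      · rw [charFn_one_of_mem hVW (.inr hx'), charFn_one_of_mem hW hx']
        simp
      · rw [charFn_one_of_notMem hVW (by simp [hx, hx']), charFn_one_of_notMem hW hx']
        simp
  · rw [charFn_of_notMem_units _ γ hγ, charFn_of_notMem_units _ γ hγ, charFn_of_notMem_units _ γ hγ]
    by_cases hx : γ.cod ∈ V
    · rw [charFn_mul_of_mem hV _ hx, charFn_of_notMem_units hW γ hγ]
      simp
    · rw [charFn_mul_of_notMem hV _ hx]
      simp

variable {M : Type*} [AddCommGroup M] (φ : Gamma O →ₙ+* AddMonoid.End M)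

/-- The germ of a module element at a point vanishes. -/
def GermZero (m : M) (y : X) : Prop :=
  ∃ (V : Set X) (hV : IsCompact V ∧ IsOpen V), y ∈ V ∧ φ (charFn O V hV) m = 0

variable {φ}

theorem map_mul_apply (f g : Gamma O) (m : M) : φ (f * g) m = φ f (φ g m) := by
  rw [map_mul]; rfl

theorem map_add_apply (f g : Gamma O) (m : M) : φ (f + g) m = φ f m + φ g m := by
  rw [map_add]; rfl

theorem map_zero_apply (m : M) : φ 0 m = 0 := by
  rw [map_zero]; rfl

theorem map_neg_apply (f : Gamma O) (m : M) : φ (-f) m = -φ f m := by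
  rw [map_neg]; rfl

theorem GermZero.charFn_mono {m : M} {V W : Set X} (hV : IsCompact V ∧ IsOpen V)
    (hW : IsCompact W ∧ IsOpen W) (h : V ⊆ W) (hm : φ (charFn O W hW) m = 0) :
    φ (charFn O V hV) m = 0 := by
  rw [← charFn_mul_charFn_of_subset hV hW h, map_mul_apply, hm, _root_.map_zero]

theorem GermZero.add {m m' : M} {y : X} (h : GermZero φ m y) (h' : GermZero φ m' y) :
    GermZero φ (m + m') y := by
  obtain ⟨V, hV, hyV, hm⟩ := h
  obtain ⟨W, hW, hyW, hm'⟩ := h'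
  obtain ⟨U, hUc, hUo, hyU, hU⟩ := exists_compactOpen
    (Filter.inter_mem (hV.2.mem_nhds hyV) (hW.2.mem_nhds hyW))
  refine ⟨U, ⟨hUc, hUo⟩, hyU, ?_⟩
  rw [_root_.map_add, charFn_mono _ hV (fun x hx => (hU hx).1) hm,
    charFn_mono _ hW (fun x hx => (hU hx).2) hm', add_zero]

theorem GermZero.zero (y : X) : GermZero φ 0 y := by
  obtain ⟨V, hVc, hVo, hy, -⟩ := exists_compactOpen (X := X) (x := y) Filter.univ_mem
  exact ⟨V, ⟨hVc, hVo⟩, hy, _root_.map_zero _⟩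

theorem GermZero.neg {m : M} {y : X} (h : GermZero φ m y) : GermZero φ (-m) y := by
  obtain ⟨V, hV, hyV, hm⟩ := h
  exact ⟨V, hV, hyV, by rw [_root_.map_neg, hm, neg_zero]⟩

/-- The elements whose germs vanish along an orbit form a submodule. -/
theorem GermZero.map {m : M} {x : X} (h : ∀ y ∈ orbit x, GermZero φ m y) (f : Gamma O) :
    ∀ y ∈ orbit x, GermZero φ (φ f m) y := by
  have : T2Space X := hX.t2Space
  intro y hy
  induction f using Gamma.induction with
  | supported f U hU hf =>
    by_cases hyU : y ∈ Arr.cod '' U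
    · obtain ⟨⟨z, y, β⟩, hβ, rfl⟩ := hyU
      obtain ⟨W, hW, hzW, hm⟩ := h z (mem_orbit_of_hom hy β)
      have hWc : IsClosed W := hW.1.isClosed
      -- Over the range of the part of `U` with sources in `W`, all support arrows of `f` have
      -- source in `W`, as the range is injective on `U`. Hence 1_V f = 1_V f 1_W, which kills `m`.
      have hV : IsCompact (Arr.cod '' (U ∩ Arr.dom ⁻¹' W)) ∧
          IsOpen (Arr.cod '' (U ∩ Arr.dom ⁻¹' W)) :=
        ⟨(hU.isCompact.inter_right (hWc.preimage hX.continuous_dom)).image hX.continuous_cod,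
          hX.isLocalHomeomorph_cod.isOpenMap _ (hU.isOpen.inter (hW.2.preimage hX.continuous_dom))⟩
      refine ⟨_, hV, ⟨_, ⟨hβ, hzW⟩, rfl⟩, ?_⟩
      have key : charFn O _ hV * f = charFn O _ hV * f * charFn O W hW := by
        refine Subtype.ext (funext fun γ => ?_)
        by_cases hγ : γ.dom ∈ W
        · rw [mul_charFn_of_mem hW _ hγ]
        · rw [mul_charFn_of_notMem hW _ hγ]
          by_cases hγV : γ.cod ∈ Arr.cod '' (U ∩ Arr.dom ⁻¹' W)
          · rw [charFn_mul_of_mem hV _ hγV]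
            refine hf.2 _ fun hγU => hγ ?_
            obtain ⟨δ, hδ, hδγ⟩ := hγV
            rw [← hU.isBisection.2 hδ.1 hγU hδγ]
            exact hδ.2
          · rw [charFn_mul_of_notMem hV _ hγV]
      rw [← map_mul_apply, key, map_mul_apply, hm, _root_.map_zero]
    · have h1 : IsClosed (Arr.cod '' U) := (hU.isCompact.image hX.continuous_cod).isClosed
      obtain ⟨V, hVc, hVo, hyV, hVU⟩ := exists_compactOpen (h1.isOpen_compl.mem_nhds hyU)
      refine ⟨V, ⟨hVc, hVo⟩, hyV, ?_⟩
      have key : charFn O V ⟨hVc, hVo⟩ * f = 0 := by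
        refine Subtype.ext (funext fun γ => ?_)
        by_cases hγ : γ.cod ∈ V
        · rw [charFn_mul_of_mem ⟨hVc, hVo⟩ _ hγ]
          exact hf.2 _ fun hγU => hVU hγ ⟨γ, hγU, rfl⟩
        · rw [charFn_mul_of_notMem ⟨hVc, hVo⟩ _ hγ]
          rfl
      rw [← map_mul_apply, key, map_zero_apply]
  | zero => rw [map_zero_apply]; exact zero y
  | add f g hf hg => rw [map_add_apply]; exact hf.add hg
  | neg f hf => rw [map_neg_apply]; exact hf.neg

/-- Finitely many compact open sets whose characteristic functions kill `m` cover `V`, and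
inclusion-exclusion handles their union. The induction is over subsets of such sets, since the
subsets arising in it need not be compact open. -/
theorem charFn_map_eq_zero {m : M} (h : ∀ y, GermZero φ m y) {V : Set X}
    (hV : IsCompact V ∧ IsOpen V) : φ (charFn O V hV) m = 0 := by
  suffices ∃ (W : Set X) (hW : IsCompact W ∧ IsOpen W), V ⊆ W ∧ φ (charFn O W hW) m = 0 by
    obtain ⟨W, hW, hVW, hm⟩ := this
    exact GermZero.charFn_mono hV hW hVW hm
  refine hV.1.induction_on (p := fun S => ∃ (W : Set X) (hW : IsCompact W ∧ IsOpen W),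
    S ⊆ W ∧ φ (charFn O W hW) m = 0) ?_ ?_ ?_ ?_
  · refine ⟨∅, ⟨isCompact_empty, isOpen_empty⟩, subset_rfl, ?_⟩
    have : charFn O (∅ : Set X) ⟨isCompact_empty, isOpen_empty⟩ = 0 := by
      refine Subtype.ext (funext fun γ => sectionOn_of_notMem (fun _ => 1) ?_)
      simp [unitSet]
    rw [this, map_zero_apply]
  · rintro S T hST ⟨W, hW, hTW, hm⟩
    exact ⟨W, hW, hST.trans hTW, hm⟩
  · rintro S T ⟨W, hW, hSW, hm⟩ ⟨W', hW', hTW', hm'⟩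
    refine ⟨W ∪ W', ⟨hW.1.union hW'.1, hW.2.union hW'.2⟩, Set.union_subset_union hSW hTW', ?_⟩
    rw [charFn_union hW hW', sub_eq_add_neg, map_add_apply, map_add_apply, map_neg_apply,
      map_mul_apply, hm, hm', _root_.map_zero]
    simp
  · intro y _
    obtain ⟨W, hW, hyW, hm⟩ := h y
    exact ⟨W, mem_nhdsWithin_of_mem_nhds (hW.2.mem_nhds hyW), W, hW, subset_rfl, hm⟩

/-- A function supported on a bisection has a characteristic function as left unit, and the germs of
`φ f m` vanish as well, so the compactness argument applies to `φ f m`. -/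
theorem map_eq_zero_of_germZero {m : M} (h : ∀ y, GermZero φ m y) (f : Gamma O) : φ f m = 0 := by
  induction f using Gamma.induction with
  | supported f U hU hf =>
    have hV : IsCompact (Arr.cod '' U) ∧ IsOpen (Arr.cod '' U) :=
      ⟨hU.isCompact.image hX.continuous_cod, hX.isLocalHomeomorph_cod.isOpenMap _ hU.isOpen⟩
    have key : charFn O _ hV * f = f := by
      refine Subtype.ext (funext fun γ => ?_)
      by_cases hγ : γ.cod ∈ Arr.cod '' U
      · exact charFn_mul_of_mem hV _ hγ
      · rw [charFn_mul_of_notMem hV _ hγ, hf.2 _ fun h => hγ ⟨γ, h, rfl⟩]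
    rw [← key, map_mul_apply]
    exact charFn_map_eq_zero
      (fun y => GermZero.map (fun z _ => h z) f y ⟨arr (𝟙 y), rfl, rfl⟩) hV
  | zero => exact map_zero_apply m
  | add f g hf hg => rw [map_add_apply, hf, hg, add_zero]
  | neg f hf => rw [map_neg_apply, hf, neg_zero]

/-- A primitive algebra comes from a groupoid with a dense orbit. -/
theorem exists_dense_orbit_of_isLeftPrimitive (hO : O.IsSheafOfFields)
    (h : IsLeftPrimitive (Gamma O)) : ∃ x : X, Dense (orbit x) := by
  obtain ⟨M, _, φ, hinj, ⟨r, m, hrm⟩, hs⟩ := h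
  by_contra hn
  push Not at hn
  -- It suffices that `m` has zero germ at every point, as this contradicts `φ r m ≠ 0`.
  refine hrm (map_eq_zero_of_germZero (fun x => ?_) r)
  have : T2Space X := hX.t2Space
  let N : AddSubgroup M :=
    { carrier := {m | ∀ y ∈ orbit x, GermZero φ m y}
      add_mem' := fun h h' y hy => (h y hy).add (h' y hy)
      zero_mem' := fun y _ => GermZero.zero y
      neg_mem' := fun h y hy => (h y hy).neg }
  have hxx : x ∈ orbit x := ⟨arr (𝟙 x), rfl, rfl⟩
  rcases hs N fun r m hm => GermZero.map hm r with hN | hN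
  · exfalso
    have hnd := hn x
    rw [dense_iff_inter_open] at hnd
    push Not at hnd
    obtain ⟨S, hS, ⟨y, hy⟩, hSx⟩ := hnd
    obtain ⟨U, hUc, hUo, hyU, hUS⟩ := exists_compactOpen (hS.mem_nhds hy)
    have hU0 : charFn O U ⟨hUc, hUo⟩ ≠ 0 := by
      intro h0
      have h1 := charFn_one_of_mem (O := O) ⟨hUc, hUo⟩ hyU
      rw [h0] at h1
      have := nontrivial_stalk hO y
      exact zero_ne_one h1
    apply hU0
    refine hinj ?_
    ext m
    rw [map_zero_apply]
    -- Each point of the orbit has a compact open neighbourhood disjoint from `U`. So 1_U maps all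
    -- of `M` into `N`, which is zero here, against faithfulness.
    have hmem : φ (charFn O U ⟨hUc, hUo⟩) m ∈ N := by
      intro z hz
      have hzU : z ∉ U := fun h => Set.eq_empty_iff_forall_notMem.1 hSx z ⟨hUS h, hz⟩
      obtain ⟨V, hVc, hVo, hzV, hVU⟩ :=
        exists_compactOpen (hUc.isClosed.isOpen_compl.mem_nhds hzU)
      refine ⟨V, ⟨hVc, hVo⟩, hzV, ?_⟩
      rw [← map_mul_apply, charFn_mul_charFn_of_disjoint _ _
        (Set.disjoint_left.2 fun x hx => hVU hx), map_zero_apply]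
    rw [hN] at hmem
    exact hmem
  · have : m ∈ N := by rw [hN]; trivial
    exact this x hxx

end DenseOrbit

/-! ### The module of an orbit: a dense orbit gives primitivity -/

section OrbitModule

variable {X : Type u} [Groupoid.{v} X] [TopologicalSpace X] [TopologicalSpace (Arr X)]
  (O : SheafOfRings.{u, v, w} X)

/-- The finitely supported families of elements of the stalks along an orbit, as functions on
arrows that are constant on the fibres of the range map. -/
def orbitModule (x : X) : AddSubgroup (Fn O) where
  carrier := {m | (∀ γ, m γ = m (arr (𝟙 γ.cod))) ∧ (∀ z, z ∉ orbit x → m (arr (𝟙 z)) = 0) ∧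
    {z : X | m (arr (𝟙 z)) ≠ 0}.Finite}
  add_mem' := by
    rintro m m' ⟨h1, h2, h3⟩ ⟨h1', h2', h3'⟩
    refine ⟨fun γ => ?_, fun z hz => ?_, (h3.union h3').subset fun z hz => ?_⟩
    · rw [Pi.add_apply, h1, h1', Pi.add_apply]
    · rw [Pi.add_apply, h2 z hz, h2' z hz, add_zero]
    · by_contra hn
      simp only [Set.mem_union, Set.mem_ofPred_eq, not_or, not_not] at hn
      exact hz (by rw [Pi.add_apply, hn.1, hn.2, add_zero])
  zero_mem' := ⟨fun _ => rfl, fun _ _ => rfl, by simp⟩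
  neg_mem' := by
    rintro m ⟨h1, h2, h3⟩
    refine ⟨fun γ => ?_, fun z hz => ?_, h3.subset fun z hz h0 => hz ?_⟩
    · rw [Pi.neg_apply, h1, Pi.neg_apply]
    · rw [Pi.neg_apply, h2 z hz, neg_zero]
    · rw [Pi.neg_apply, h0, neg_zero]

variable {O}

/-- On functions constant along range fibres, convolution becomes the action on families of stalk
elements. Realizing the module inside `Fn O` lets `conv_assoc` and the additivity of convolution
supply the module axioms. -/
theorem conv_orbitModule {x : X} (f : Fn O) {m : Fn O} (hm : m ∈ orbitModule O x) {y z : X}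
    (γ : y ⟶ z) : conv f m (arr γ) =
      ∑ᶠ b : Σ y : X, (y ⟶ z), f (arr b.2) * O.act b.2 (m (arr (𝟙 b.1))) := by
  rw [conv_apply]
  refine finsum_congr fun b => ?_
  rw [hm.1]

theorem conv_mem_orbitModule {H : Set (Arr X)} {x : X} {f m : Fn O} (hf : f ∈ gammaOn O H)
    (hm : m ∈ orbitModule O x) : conv f m ∈ orbitModule O x := by
  refine ⟨fun γ => ?_, fun z hz => ?_, ?_⟩
  · obtain ⟨y, z, γ⟩ := γ
    rw [conv_orbitModule f hm, conv_orbitModule f hm]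
  · rw [conv_orbitModule f hm]
    refine finsum_eq_zero_of_forall_eq_zero fun b => ?_
    rw [hm.2.1, map_zero, mul_zero]
    rintro ⟨⟨a, c, g⟩, ha, hc⟩
    dsimp only at hc
    subst hc
    exact hz ⟨⟨a, z, g ≫ b.2⟩, ha, rfl⟩
  · refine (hm.2.2.biUnion fun y _ => (finite_dom_support hf y).image Arr.cod).subset fun z hz => ?_
    obtain ⟨b, hb⟩ : ∃ b : Σ y : X, (y ⟶ z), f (arr b.2) * O.act b.2 (m (arr (𝟙 b.1))) ≠ 0 := by
      by_contra hn
      push Not at hn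
      refine hz ?_
      rw [conv_orbitModule f hm]
      exact finsum_eq_zero_of_forall_eq_zero hn
    refine Set.mem_biUnion (x := b.1) ?_ ⟨arr b.2, ⟨rfl, ?_⟩, rfl⟩
    · exact fun h0 => hb (by rw [h0, map_zero, mul_zero])
    · exact fun h0 => hb (by rw [h0, zero_mul])

open Classical in
/-- The component at `z` of an element of the module of an orbit. -/
noncomputable def component {x : X} (m : orbitModule O x) (z : X) : orbitModule O x :=
  ⟨fun γ => if γ.cod = z then m.1 γ else 0, by
    refine ⟨fun γ => ?_, fun y hy => ?_, m.2.2.2.subset fun y hy h0 => hy ?_⟩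
    · dsimp only
      rw [m.2.1]
    · dsimp only
      rw [m.2.2.1 y hy, ite_self]
    · dsimp only
      rw [h0, ite_self]⟩

theorem sum_component {x : X} (m : orbitModule O x) :
    ∑ z ∈ m.2.2.2.toFinset, component m z = m := by
  refine Subtype.ext (funext fun γ => ?_)
  rw [AddSubgroup.val_finsetSum, Finset.sum_apply, Finset.sum_eq_single γ.cod]
  · simp [component]
  · intro z _ hz
    simp [component, hz.symm]
  · intro h
    rw [Set.Finite.mem_toFinset, Set.mem_ofPred_eq, not_not] at h
    simp [component, m.2.1 γ, h]

variable [hX : IsAmple X]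

variable (O) in
/-- The action of `Γ_c(𝒢, 𝒪)` on the module of an orbit. -/
noncomputable def orbitAction (x : X) : Gamma O →ₙ+* AddMonoid.End (orbitModule O x) where
  toFun f :=
    { toFun := fun m => ⟨conv f.1 m.1, conv_mem_orbitModule f.2 m.2⟩
      map_zero' := Subtype.ext (conv_zero _)
      map_add' := fun m m' => Subtype.ext (conv_add (finFib_of_mem f.2) m.1 m'.1) }
  map_mul' f g := by
    ext m : 1
    exact Subtype.ext (conv_assoc (finFib_of_mem f.2) (finFib_of_mem g.2))
  map_zero' := by
    ext m : 1
    exact Subtype.ext (zero_conv _)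
  map_add' f g := by
    ext m : 1
    exact Subtype.ext (add_conv (finFib_of_mem f.2) (finFib_of_mem g.2) m.1)

theorem orbitAction_val (x : X) (f : Gamma O) (m : orbitModule O x) :
    (orbitAction O x f m).1 = conv f.1 m.1 := rfl

/-- Every component is a multiple of every nonzero element. -/
theorem exists_orbitAction_eq_component (hO : O.IsSheafOfFields) {x : X} {m : orbitModule O x}
    (hm : m ≠ 0) (m' : orbitModule O x) (z : X) : ∃ f, orbitAction O x f m = component m' z := by
  classical
  have : T2Space X := hX.t2Space
  by_cases hz : z ∈ orbit x
  swap
  · refine ⟨0, Subtype.ext (funext fun γ => ?_)⟩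
    rw [_root_.map_zero]
    by_cases h : γ.cod = z
    · simp [component, m'.2.1 γ, m'.2.2.1 γ.cod (h ▸ hz)]
    · simp [component, h]
  obtain ⟨y, hy⟩ : ∃ y, m.1 (arr (𝟙 y)) ≠ 0 := by
    by_contra hn
    push Not at hn
    refine hm (Subtype.ext (funext fun γ => ?_))
    rw [m.2.1, hn]
    rfl
  have hyx : y ∈ orbit x := by_contra fun h => hy (m.2.2.1 y h)
  obtain ⟨γ⟩ : Nonempty (y ⟶ z) := by
    obtain ⟨⟨a, b, g⟩, ha, hb⟩ := hz
    obtain ⟨⟨a', b', g'⟩, ha', hb'⟩ := hyx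
    dsimp at ha hb ha' hb'
    subst ha hb ha' hb'
    exact ⟨Groupoid.inv g' ≫ g⟩
  -- The coefficient divides by the transport of `m` at `y`; the inverse is taken in the stalk at
  -- `y` and carried along `γ`.
  obtain ⟨c, hc⟩ : ∃ c, c * O.act γ (m.1 (arr (𝟙 y))) = m'.1 (arr (𝟙 z)) := by
    obtain ⟨d, hd⟩ := (hO y).mul_inv_cancel hy
    refine ⟨m'.1 (arr (𝟙 z)) * O.act γ d, ?_⟩
    rw [mul_assoc, ← map_mul, (hO y).mul_comm, hd, map_one, mul_one]
  -- The remaining support of `m` is finite, hence closed, so a small bisection around `γ` has no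
  -- sources in it. Then `γ` is the only arrow that contributes.
  have hS : Arr.dom ⁻¹' (({y' : X | m.1 (arr (𝟙 y')) ≠ 0} \ {y})ᶜ) ∈ 𝓝 (arr γ) :=
    ((m.2.2.2.subset Set.sdiff_subset).isClosed.isOpen_compl.preimage
      hX.continuous_dom).mem_nhds (by simp)
  obtain ⟨U, s, hU, hγU, hUS, hs, hmem⟩ := exists_sectionOn (O := O) hS c
  let f : Gamma O := ⟨sectionOn U s, hmem _ (Set.subset_univ _)⟩
  refine ⟨f, Subtype.ext (funext ?_)⟩
  rintro ⟨p, q, δ⟩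
  rw [orbitAction_val, conv_orbitModule _ m.2]
  change (∑ᶠ b : Σ y : X, (y ⟶ q),
    sectionOn U s (arr b.2) * O.act b.2 (m.1 (arr (𝟙 b.1))) : O.stalk q) = _
  have huniq : ∀ b : Σ y : X, (y ⟶ q),
      sectionOn U s (arr b.2) * O.act b.2 (m.1 (arr (𝟙 b.1))) ≠ 0 → arr b.2 = arr γ := by
    intro b hb
    have h1 : arr b.2 ∈ U := by
      by_contra hn
      exact hb (by rw [sectionOn_of_notMem s hn, zero_mul])
    have h2 : m.1 (arr (𝟙 b.1)) ≠ 0 := fun h0 => hb (by rw [h0, map_zero, mul_zero])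
    have h3 : b.1 = y := by
      by_contra hn
      exact hUS h1 ⟨h2, hn⟩
    exact hU.isBisection.1 h1 hγU h3
  by_cases hq : q = z
  · subst hq
    rw [finsum_eq_single _ (⟨y, γ⟩ : Σ y : X, (y ⟶ q))]
    · simp only [component, if_true]
      rw [sectionOn_of_mem s hγU, hs, hc, m'.2.1 ⟨p, q, δ⟩]
    · intro b hne
      by_contra hb
      apply hne
      have := huniq b hb
      obtain ⟨b1, b2⟩ := b
      cases this
      rfl
  · simp only [component, if_neg hq]
    refine finsum_eq_zero_of_forall_eq_zero fun b => ?_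
    by_contra hb
    exact hq (congrArg Arr.cod (huniq b hb))

/-- A maximal commutative diagonal and a dense orbit make the module of the orbit faithful. -/
theorem orbitAction_injective (hO : O.IsSheafOfFields)
    (hmax : IsMaximalCommutative (diagonal O)) {x : X} (hx : Dense (orbit x)) :
    Function.Injective (orbitAction O x) := by
  classical
  rw [injective_iff_map_eq_zero]
  intro f hf
  by_contra hf0
  obtain ⟨a, had, haI, ha0⟩ := exists_mem_diagonal_of_mem_ideal hO hmax
    (AddMonoidHom.ker (orbitAction O x : Gamma O →+ AddMonoid.End (orbitModule O x)))
    (fun r f hf => by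
      change orbitAction O x (r * f) = 0
      rw [map_mul, show orbitAction O x f = 0 from hf, mul_zero])
    (fun r f hf => by
      change orbitAction O x (f * r) = 0
      rw [map_mul, show orbitAction O x f = 0 from hf, zero_mul]) hf hf0
  have haI' : orbitAction O x a = 0 := haI
  have ha : a.1 ∈ gammaOn O (units X) := had
  have hau := eq_zero_of_mem_gammaOn ha
  obtain ⟨y, hy⟩ : ∃ y, a.1 (arr (𝟙 y)) ≠ 0 := by
    by_contra hn
    push Not at hn
    refine ha0 (Subtype.ext (funext fun γ => ?_))
    by_cases hγ : γ ∈ units X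
    · obtain ⟨y, rfl⟩ := hγ
      exact hn y
    · exact hau γ hγ
  obtain ⟨S, hS, hSo, hyS⟩ := mem_nhds_iff.1
    (eventually_ne_zero hO (continuous_diag ha).continuousAt hy)
  obtain ⟨z, hzS, hz⟩ := hx.inter_open_nonempty S hSo ⟨y, hyS⟩
  -- The element 1 of the stalk at `z`: the diagonal element `a` multiplies it by its value at `z`,
  -- which is nonzero.
  let m : orbitModule O x := ⟨fun γ => if γ.cod = z then 1 else 0, by
    refine ⟨fun γ => rfl, fun y hy => if_neg (by rintro rfl; exact hy hz),
      (Set.finite_singleton z).subset fun y hy => ?_⟩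
    by_contra hn
    exact hy (if_neg hn)⟩
  have h1 : (orbitAction O x a m).1 (arr (𝟙 z)) = a.1 (arr (𝟙 z)) := by
    rw [orbitAction_val, diag_conv hau]
    simp [m]
  rw [haI'] at h1
  exact hS hzS h1.symm

/-- The module of a dense orbit is simple and faithful. -/
theorem isLeftPrimitive_of_dense_orbit (hO : O.IsSheafOfFields) (hmax : IsMaximalCommutative (diagonal O)) {x : X}
    (hx : Dense (orbit x)) : IsLeftPrimitive (Gamma O) := by
  classical
  refine ⟨orbitModule O x, inferInstance, orbitAction O x, orbitAction_injective hO hmax hx, ?_, ?_⟩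
  · have hxx : x ∈ orbit x := ⟨arr (𝟙 x), rfl, rfl⟩
    obtain ⟨V, hVc, hVo, hxV, -⟩ := exists_compactOpen (X := X) (x := x) Filter.univ_mem
    by_contra hn
    push Not at hn
    -- Were the action zero, faithfulness would make every ring element zero, in particular a
    -- characteristic function equal to 1 at `x`.
    have h0 : charFn O V ⟨hVc, hVo⟩ = 0 := orbitAction_injective hO hmax hx (by
      ext m : 1
      rw [hn, _root_.map_zero]
      rfl)
    have h1 := charFn_one_of_mem (O := O) ⟨hVc, hVo⟩ hxV
    rw [h0] at h1
    have := nontrivial_stalk hO x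
    exact zero_ne_one h1
  · intro N hN
    by_cases hbot : N = ⊥
    · exact .inl hbot
    · obtain ⟨m, hm, hm0⟩ := N.bot_or_exists_ne_zero.resolve_left hbot
      refine .inr ((AddSubgroup.eq_top_iff' N).2 fun m' => ?_)
      rw [← sum_component m']
      refine N.sum_mem fun z _ => ?_
      obtain ⟨f, hf⟩ := exists_orbitAction_eq_component hO hm0 m' z
      rw [← hf]
      exact hN f m hm

end OrbitModule

end GroupoidAlg

theorem theoremt {X : Type u} [CategoryTheory.Groupoid.{v} X] [TopologicalSpace X]
    [TopologicalSpace (GroupoidAlg.Arr X)] [GroupoidAlg.IsAmple X]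
    (O : GroupoidAlg.SheafOfRings.{u, v, w} X) (hO : O.IsSheafOfFields)
    (hmax : GroupoidAlg.IsMaximalCommutative (GroupoidAlg.diagonal O)) :
    GroupoidAlg.IsLeftPrimitive (GroupoidAlg.Gamma O) ↔
      ∃ x : X, Dense (GroupoidAlg.orbit x) :=
  ⟨GroupoidAlg.exists_dense_orbit_of_isLeftPrimitive hO,
    fun ⟨_, hx⟩ => GroupoidAlg.isLeftPrimitive_of_dense_orbit hO hmax hx⟩
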